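/- A sequence $D=(d_1,\dots,d_n)$ with $d_1\ge d_2\ge\dots\ge d_n$ is called a degree sequence of a tree of order $n$ if its terms are the degrees of the vertices of some tree with $n$ vertices. For two sequences of length $n$, write $B\preccurlyeq D$ if, for every permutation $\sigma$ of $\{1,\dots,n\}$, the sequence $D$ majorizes $(b_{\sigma(1)},\dots,b_{\sigma(n)})$, that is, $\sum_{i=1}^{l} b_{\sigma(i)}\le\sum_{i=1}^{l} d_i$ for all $1\le l\le n$. The greedy tree $G(D)$ is the rooted tree on vertices $v_1,\dots,v_n$ with root $v_1$ and $\deg v_i=d_i$ obtained by processing $v_1,v_2,\dots$ in this order and giving each vertex, as its children, the next unused vertices in the list: $d_1$ of them for the root $v_1$, and $d_i-1$ of them for $v_i$ with $i\ge 2$. Let $C(k;G)$ denote the number of closed walks of length $k$ in a graph $G$, i.e. of sequences $w_1w_2\dots w_{k+1}$ of vertices with $w_iw_{i+1}$ an edge for $1\le i\le k$ and $w_{k+1}=w_1$. **Theorem.** Let $D=(d_1,\dots,d_n)$ and $B=(b_1,\dots,b_n)$ be degree sequences of trees of the same order $n$ such that $B\preccurlyeq D$. Then for every integer $k\ge 0$,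 $$C(k;G(B))\le C(k;G(D)).$$ If $B\ne D$ and $k$ is even with $k\ge 4$, then the inequality is strict. -/

import Mathlib

/-- `d = (d 0, …, d (n-1))` is the degree sequence of a tree of order `n`: it is non-increasing and
its terms are the degrees of the vertices of some tree. -/
def IsTreeDegreeSequence {n : ℕ} (d : Fin n → ℕ) : Prop :=
  Antitone d ∧
    ∃ T : SimpleGraph (Fin n), T.IsTree ∧ ∀ v, (T.neighborSet v).ncard = d v

/-- `a` majorizes `b`: every initial sum of `a` is at least the corresponding one of `b`. -/
def Majorizes {n : ℕ} (a b : Fin n → ℕ) : Prop :=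
  ∀ k : Fin n, ∑ i ∈ Finset.Iic k, b i ≤ ∑ i ∈ Finset.Iic k, a i

/-- `B ≼ A`: the sequence `A` majorizes every rearrangement of `B`. -/
def MajorizedBy {n : ℕ} (B A : Fin n → ℕ) : Prop :=
  ∀ σ : Equiv.Perm (Fin n), Majorizes A (B ∘ σ)

/-- The number of children of vertex `i` in the greedy construction: all neighbours of the
root `0` are children, while every other vertex has exactly one neighbour that is not. -/
def greedyNumChildren {n : ℕ} (d : Fin n → ℕ) (i : Fin n) : ℕ :=
  if i.val = 0 then d i else d i - 1

/-- The label of the first child of vertex `i`: it comes directly after the root `0` and the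
children of all vertices before `i`. -/
def greedyFirstChild {n : ℕ} (d : Fin n → ℕ) (i : Fin n) : ℕ :=
  1 + ∑ m ∈ Finset.Iio i, greedyNumChildren d m

/-- Vertex `j` is one of the children of vertex `i`. -/
def IsGreedyChild {n : ℕ} (d : Fin n → ℕ) (i j : Fin n) : Prop :=
  greedyFirstChild d i ≤ j.val ∧ j.val < greedyFirstChild d i + greedyNumChildren d i

/-- The greedy tree `G(d)` of a non-increasing tree degree sequence `d`.
The vertices `0, …, n-1` are listed level by level, starting with the root `0`, and within each
level from left to right. Vertex `i` is assigned the degree `d i`, so that degrees are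
non-increasing along each level and from one level to the next; going through the vertices in this
order, each one takes the next unused labels (`d 0` of them for the root, `d i - 1` otherwise)
as its children. -/
def greedyTree {n : ℕ} (d : Fin n → ℕ) : SimpleGraph (Fin n) :=
  SimpleGraph.fromRel (IsGreedyChild d)

/-- `C(k; G)`: the number of closed walks of length `k` in a finite graph, i.e. of walks with `k`
steps that start and end at the same vertex (walks with different starting points are different). -/
noncomputable def numClosedWalks {V : Type*} [Finite V] (k : ℕ) (G : SimpleGraph V) : ℕ :=
  Nat.card (Σ v : V, {w : G.Walk v v // w.length = k})

/-! Root a tree and let `u i` be the sum, over the children `j` of vertex `i`, of `1 / (1 - X ^ 2 *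
u j)`. Then `1 - X A` factors as `U L Uᵀ` with `U` unipotent and `L` diagonal with entries `1 - X ^
2 * u i`. Taking logarithmic derivatives, the closed walk series `∑ tr (A ^ (k+1)) X ^ k` becomes
the sum over the vertices of `nodeSeries (u i)` (`trace_pow_of_parent`).

All operations occurring here have nonnegative coefficients and respect weak majorization (`Dom`):
sums, products, geometric series, and summation over consecutive blocks, which is how a level is
computed from the one below it. Hence, among forests with given child counts on every level, those
with sorted levels have coefficientwise the largest series, and enlarging the level multisets in the
majorization order helps further (`walks_le_of_sorted`).

Levels can be measured from a root, or from the edge joining the root to its first child. Sorting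
alternately with respect to both lowers the sum of the depths until the degrees do not increase in
breadth-first order (`exists_improvement`, `exists_ordered`). Such an ordered tree is determined
level by level by its degrees (`Ordered.dlev_eq`), and the greedy tree is one
(`IsGreedyFamily.ordered`).

To compare two degree sequences, take the ordered tree of the smaller one and move one unit of
degree between neighbours in breadth-first order. These lie on a common level with respect to the
root or to the first edge, so the walk counts do not drop (`Ordered.exists_transfer`). The move can
be chosen so that the result stays below the larger sequence (`exists_consecutive`), and induction
on the remaining gap finishes (`Ordered.treeWalks_max`). Strictness comes from the part of the
series that counts walks in stars: it contributes `2 * c ^ k` to length `2 * k`, strictly convex in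
`c` for `2 ≤ k`. -/

namespace GreedyWalks

/-! ### Weak majorization of sequences. -/

open Finset

/-- `a` is a non-increasing nonnegative sequence whose initial sums bound all sums of as many
terms of the nonnegative family `a'`. -/
structure Dom (a' a : ℕ → ℚ) : Prop where
  nonneg' : ∀ i, 0 ≤ a' i
  nonneg : ∀ i, 0 ≤ a i
  anti : Antitone a
  le : ∀ S : Finset ℕ, ∑ i ∈ S, a' i ≤ ∑ i ∈ range #S, a i

/-- Abel summation: the weights decrease and stay nonnegative, so the weighted sum of the
differences is at least the last weight times their plain sum. -/
theorem sum_mul_le_of_partial_sums (a' a b : ℕ → ℚ) (s : ℕ)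
    (hb : ∀ i j, i ≤ j → j < s → b j ≤ b i) (hb0 : ∀ i, 0 ≤ b i)
    (h : ∀ t ≤ s, ∑ i ∈ range t, a' i ≤ ∑ i ∈ range t, a i) :
    ∑ i ∈ range s, a' i * b i ≤ ∑ i ∈ range s, a i * b i := by
  have key : ∀ t, t + 1 ≤ s → b t * ∑ i ∈ range (t + 1), (a i - a' i) ≤
      ∑ i ∈ range (t + 1), (a i - a' i) * b i := by
    intro t
    induction t with
    | zero => intro _; simp [mul_comm]
    | succ t ih =>
      intro ht
      have h1 := ih (by omega)
      have h2 : 0 ≤ ∑ i ∈ range (t + 1), (a i - a' i) := by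
        have := h (t + 1) (by omega)
        rw [sum_sub_distrib]; linarith
      have h3 := hb t (t + 1) (by omega) (by omega)
      rw [sum_range_succ _ (t + 1), sum_range_succ _ (t + 1)]
      have h4 := mul_le_mul_of_nonneg_right h3 h2
      linarith
  rcases s with _ | s
  · simp
  · have h1 := key s le_rfl
    have h2 : 0 ≤ ∑ i ∈ range (s + 1), (a i - a' i) := by
      have := h (s + 1) le_rfl
      rw [sum_sub_distrib]; linarith
    have h3 := mul_nonneg (hb0 s) h2
    have h4 : ∑ i ∈ range (s + 1), (a i - a' i) * b i =
        ∑ i ∈ range (s + 1), a i * b i - ∑ i ∈ range (s + 1), a' i * b i := by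
      rw [← sum_sub_distrib]; exact sum_congr rfl fun _ _ => by ring
    linarith

theorem exists_antitone_enumeration (b : ℕ → ℚ) (S : Finset ℕ) :
    ∃ e : ℕ → ℕ, Set.InjOn e (range #S) ∧ (range #S).image e = S ∧
      ∀ i j, i ≤ j → j < #S → b (e j) ≤ b (e i) := by
  induction S using Finset.induction_on_min_value b with
  | empty => exact ⟨id, by simp⟩
  | insert x S hx hmin ih =>
    obtain ⟨e, he, him, hanti⟩ := ih
    have hne : ∀ i ∈ range #S, Function.update e #S x i = e i := fun i hi =>
      Function.update_of_ne (by have := mem_range.1 hi; omega) _ _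
    have hmem : ∀ i < #S, e i ∈ S := fun i hi => by
      have := mem_image_of_mem e (mem_range.2 hi)
      rwa [him] at this
    have himage : (range #(insert x S)).image (Function.update e #S x) = insert x S := by
      rw [card_insert_of_notMem hx, range_add_one, image_insert, Function.update_self]
      congr 1
      rw [image_congr (g := e) (fun i hi => hne i hi), him]
    refine ⟨Function.update e #S x, ?_, himage, ?_⟩
    · rw [← card_image_iff, himage, card_range]
    · rw [card_insert_of_notMem hx]
      intro i j hij hj
      rcases Nat.lt_succ_iff_lt_or_eq.1 hj with hj | rfl
      · rw [hne j (mem_range.2 hj), hne i (mem_range.2 (by omega))]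
        exact hanti i j hij hj
      · rw [Function.update_self]
        rcases hij.lt_or_eq with hi | rfl
        · rw [hne i (mem_range.2 hi)]
          exact hmin _ (hmem i hi)
        · rw [Function.update_self]

namespace Dom

variable {a' a b' b : ℕ → ℚ}

theorem zero : Dom (fun _ => 0) (fun _ => 0) :=
  ⟨fun _ => le_rfl, fun _ => le_rfl, fun _ _ _ => le_rfl, fun _ => by simp⟩

theorem add (ha : Dom a' a) (hb : Dom b' b) :
    Dom (fun i => a' i + b' i) (fun i => a i + b i) where
  nonneg' i := add_nonneg (ha.nonneg' i) (hb.nonneg' i)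
  nonneg i := add_nonneg (ha.nonneg i) (hb.nonneg i)
  anti := ha.anti.add hb.anti
  le S := by
    rw [sum_add_distrib, sum_add_distrib]
    exact add_le_add (ha.le S) (hb.le S)

theorem const_mul (ha : Dom a' a) {r : ℚ} (hr : 0 ≤ r) :
    Dom (fun i => r * a' i) (fun i => r * a i) where
  nonneg' i := mul_nonneg hr (ha.nonneg' i)
  nonneg i := mul_nonneg hr (ha.nonneg i)
  anti _ _ h := mul_le_mul_of_nonneg_left (ha.anti h) hr
  le S := by
    rw [← mul_sum, ← mul_sum]
    exact mul_le_mul_of_nonneg_left (ha.le S) hr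

/-- Enumerate `S` by decreasing `b'`. Two Abel summations then replace `a'` by `a` against the
weights `b'`, and `b'` by `b` against the weights `a`. -/
theorem mul (ha : Dom a' a) (hb : Dom b' b) :
    Dom (fun i => a' i * b' i) (fun i => a i * b i) where
  nonneg' i := mul_nonneg (ha.nonneg' i) (hb.nonneg' i)
  nonneg i := mul_nonneg (ha.nonneg i) (hb.nonneg i)
  anti i j h := mul_le_mul (ha.anti h) (hb.anti h) (hb.nonneg j) (ha.nonneg i)
  le S := by
    obtain ⟨e, he, him, hanti⟩ := exists_antitone_enumeration b' S
    have hpre : ∀ {c' c : ℕ → ℚ}, Dom c' c → ∀ t ≤ #S,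
        ∑ i ∈ range t, c' (e i) ≤ ∑ i ∈ range t, c i := by
      intro c' c hc t ht
      have hinj : Set.InjOn e (range t) :=
        he.mono (by simpa using ht)
      have := hc.le ((range t).image e)
      rwa [card_image_of_injOn hinj, card_range, sum_image hinj] at this
    calc ∑ i ∈ S, a' i * b' i = ∑ i ∈ range #S, a' (e i) * b' (e i) := by
          conv_lhs => rw [← him]
          rw [sum_image he]
      _ ≤ ∑ i ∈ range #S, a i * b' (e i) :=
          sum_mul_le_of_partial_sums (fun i => a' (e i)) a (fun i => b' (e i)) #S hanti
            (fun i => hb.nonneg' _) (hpre ha)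
      _ = ∑ i ∈ range #S, b' (e i) * a i := sum_congr rfl fun _ _ => mul_comm _ _
      _ ≤ ∑ i ∈ range #S, b i * a i :=
          sum_mul_le_of_partial_sums (fun i => b' (e i)) b a #S (fun i j h _ => ha.anti h)
            ha.nonneg (hpre hb)
      _ = ∑ i ∈ range #S, a i * b i := sum_congr rfl fun _ _ => mul_comm _ _

theorem sum {ι : Type*} (s : Finset ι) {p' p : ι → ℕ → ℚ}
    (h : ∀ k ∈ s, Dom (p' k) (p k)) :
    Dom (fun i => ∑ k ∈ s, p' k i) (fun i => ∑ k ∈ s, p k i) := by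
  classical
  induction s using Finset.induction_on with
  | empty => simpa using zero
  | insert x s hx ih =>
    simp only [sum_insert hx]
    exact (h x (mem_insert_self _ _)).add (ih fun k hk => h k (mem_insert_of_mem hk))

/-- Summing consecutive blocks of a dominated family. -/
theorem blocks (hy : Dom a' a) {c' c : ℕ → ℕ} (hc : Antitone c)
    (hle : ∀ S : Finset ℕ, ∑ i ∈ S, c' i ≤ ∑ i ∈ range #S, c i) :
    Dom (fun i => ∑ j ∈ range (c' i), a' (∑ m ∈ range i, c' m + j))
      (fun i => ∑ j ∈ range (c i), a (∑ m ∈ range i, c m + j)) where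
  nonneg' i := sum_nonneg fun _ _ => hy.nonneg' _
  nonneg i := sum_nonneg fun _ _ => hy.nonneg _
  anti i i' h := by
    have h1 : ∑ m ∈ range i, c m ≤ ∑ m ∈ range i', c m :=
      sum_le_sum_of_subset (range_subset_range.2 h)
    calc ∑ j ∈ range (c i'), a (∑ m ∈ range i', c m + j)
        ≤ ∑ j ∈ range (c i'), a (∑ m ∈ range i, c m + j) :=
          sum_le_sum fun j _ => hy.anti (by omega)
      _ ≤ ∑ j ∈ range (c i), a (∑ m ∈ range i, c m + j) :=
          sum_le_sum_of_subset_of_nonneg (range_subset_range.2 (hc h)) fun _ _ _ => hy.nonneg _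
  le S := by
    -- Blocks are sums over consecutive intervals. Those chosen by `S` are disjoint, so their union
    -- is a single index set to which the hypothesis on `a'` applies; the first blocks of `a` form
    -- an initial segment.
    have hIco : ∀ (f : ℕ → ℚ) (d : ℕ → ℕ) i, ∑ j ∈ range (d i), f (∑ m ∈ range i, d m + j) =
        ∑ j ∈ Ico (∑ m ∈ range i, d m) (∑ m ∈ range (i + 1), d m), f j := by
      intro f d i
      rw [sum_Ico_eq_sum_range, sum_range_succ, Nat.add_sub_cancel_left]
    have hmono : Monotone fun i => ∑ m ∈ range i, c' m := fun i j h =>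
      sum_le_sum_of_subset (range_subset_range.2 h)
    have hdisj : Set.PairwiseDisjoint (↑S : Set ℕ)
        fun i => Ico (∑ m ∈ range i, c' m) (∑ m ∈ range (i + 1), c' m) := by
      have := hmono.pairwise_disjoint_on_Ico_succ
      intro i _ j _ hij
      have h2 := this hij
      rw [Function.onFun, ← Finset.disjoint_coe]
      simpa using h2
    have hcard : #(S.biUnion fun i => Ico (∑ m ∈ range i, c' m) (∑ m ∈ range (i + 1), c' m)) =
        ∑ i ∈ S, c' i := by
      rw [card_biUnion hdisj]
      exact sum_congr rfl fun i _ => by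
        rw [Nat.card_Ico, sum_range_succ, Nat.add_sub_cancel_left]
    have hright : ∀ s, ∑ i ∈ range s, ∑ j ∈ range (c i), a (∑ m ∈ range i, c m + j) =
        ∑ j ∈ range (∑ i ∈ range s, c i), a j := by
      intro s
      induction s with
      | zero => simp
      | succ s ih => rw [sum_range_succ, ih, sum_range_succ _ s, sum_range_add]
    rw [hright]
    simp only [hIco]
    rw [← sum_biUnion hdisj]
    refine (hy.le _).trans ?_
    rw [hcard]
    exact sum_le_sum_of_subset_of_nonneg (range_subset_range.2 (hle S)) fun _ _ _ => hy.nonneg _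

theorem natCast {c' c : ℕ → ℕ} (hc : Antitone c)
    (hle : ∀ S : Finset ℕ, ∑ i ∈ S, c' i ≤ ∑ i ∈ range #S, c i) :
    Dom (fun i => (c' i : ℚ)) (fun i => (c i : ℚ)) where
  nonneg' i := by positivity
  nonneg i := by positivity
  anti i j h := Nat.cast_le.2 (hc h)
  le S := by exact_mod_cast hle S

end Dom

end GreedyWalks

/-! ### Power series that respect majorization. -/

namespace GreedyWalks

open Finset PowerSeries

/-- Coefficientwise domination of families of power series. -/
def DomS (p' p : ℕ → ℚ⟦X⟧) : Prop :=
  ∀ k, Dom (fun i => coeff k (p' i)) (fun i => coeff k (p i))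

/-- The total of the closed walk series contributed by a vertex whose children have walk series
with sum `u`: the logarithmic derivative of `1 / (1 - X ^ 2 * u)`. -/
noncomputable def nodeSeries (u : ℚ⟦X⟧) : ℚ⟦X⟧ :=
  d⁄dX ℚ (X ^ 2 * u) * (1 - X ^ 2 * u)⁻¹

theorem one_sub_mul_inv (u : ℚ⟦X⟧) : (1 - X ^ 2 * u) * (1 - X ^ 2 * u)⁻¹ = 1 :=
  PowerSeries.mul_inv_cancel _ (by simp)

theorem eq_inv_of_mul_eq_one {u f : ℚ⟦X⟧} (h : (1 - X ^ 2 * u) * f = 1) :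
    f = (1 - X ^ 2 * u)⁻¹ := by
  have h2 := one_sub_mul_inv u
  calc f = ((1 - X ^ 2 * u) * (1 - X ^ 2 * u)⁻¹) * f := by rw [h2, one_mul]
    _ = (1 - X ^ 2 * u)⁻¹ * ((1 - X ^ 2 * u) * f) := by ring
    _ = _ := by rw [h, mul_one]

theorem inv_eq_one_add (u : ℚ⟦X⟧) :
    (1 - X ^ 2 * u)⁻¹ = 1 + X ^ 2 * (u * (1 - X ^ 2 * u)⁻¹) := by
  linear_combination one_sub_mul_inv u

namespace DomS

variable {p' p q' q : ℕ → ℚ⟦X⟧}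

theorem add (hp : DomS p' p) (hq : DomS q' q) :
    DomS (fun i => p' i + q' i) (fun i => p i + q i) := fun k => by
  simpa using (hp k).add (hq k)

theorem mul (hp : DomS p' p) (hq : DomS q' q) :
    DomS (fun i => p' i * q' i) (fun i => p i * q i) := fun k => by
  simp only [coeff_mul]
  exact Dom.sum _ fun x _ => (hp x.1).mul (hq x.2)

theorem X_sq_mul (hp : DomS p' p) :
    DomS (fun i => X ^ 2 * p' i) (fun i => X ^ 2 * p i) := fun k => by
  simp only [coeff_X_pow_mul']
  split_ifs
  · exact hp _
  · exact Dom.zero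

theorem derivative (hp : DomS p' p) :
    DomS (fun i => d⁄dX ℚ (p' i)) (fun i => d⁄dX ℚ (p i)) := fun k => by
  simp only [coeff_derivative, mul_comm _ ((k : ℚ) + 1)]
  exact (hp _).const_mul (by positivity)

/-- Weighted families of series `1 / (1 - X ^ 2 * u)`. -/
theorem inv {e' e : ℕ → ℚ} (he : Dom e' e) (hp : DomS p' p) :
    DomS (fun i => C (e' i) * (1 - X ^ 2 * p' i)⁻¹) (fun i => C (e i) * (1 - X ^ 2 * p i)⁻¹) := by
  -- The geometric series satisfies a recursion in lower coefficients with nonnegative operations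
  -- only. The weight `r` enters just through the constant term; 0/1 weights later cut a family off
  -- at a finite length.
  have rec_coeff : ∀ (r : ℚ) (u : ℚ⟦X⟧) k, coeff k (C r * (1 - X ^ 2 * u)⁻¹) =
      (if k = 0 then r else 0) + if 2 ≤ k then
        ∑ x ∈ antidiagonal (k - 2), coeff x.1 u * coeff x.2 (C r * (1 - X ^ 2 * u)⁻¹) else 0 := by
    intro r u k
    have : C r * (1 - X ^ 2 * u)⁻¹ = C r + X ^ 2 * (u * (C r * (1 - X ^ 2 * u)⁻¹)) := by
      conv_lhs => rw [inv_eq_one_add]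
      ring
    conv_lhs => rw [this]
    rw [map_add, coeff_X_pow_mul', coeff_mul, coeff_C]
  intro k
  induction k using Nat.strong_induction_on with
  | _ k ih =>
    simp only [rec_coeff _ _ k]
    refine Dom.add ?_ ?_
    · split_ifs
      · exact he
      · exact Dom.zero
    · split_ifs with h
      · refine Dom.sum _ fun x hx => (hp x.1).mul (ih x.2 ?_)
        have := mem_antidiagonal.1 hx
        omega
      · exact Dom.zero

theorem inv_one (hp : DomS p' p) :
    DomS (fun i => (1 - X ^ 2 * p' i)⁻¹) (fun i => (1 - X ^ 2 * p i)⁻¹) := by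
  simpa using inv (e' := fun _ => 1) (e := fun _ => 1)
    ⟨fun _ => zero_le_one, fun _ => zero_le_one, fun _ _ _ => le_rfl, fun S => by simp⟩ hp

/-- The series `1 / (1 - X ^ 2 * u)`, cut off at given lengths. -/
theorem inv_cutoff {l' l : ℕ} (hl : l' ≤ l) (hp : DomS p' p) :
    DomS (fun i => if i < l' then (1 - X ^ 2 * p' i)⁻¹ else 0)
      (fun i => if i < l then (1 - X ^ 2 * p i)⁻¹ else 0) := by
  have hind : Dom (fun i => if i < l' then 1 else 0) (fun i => if i < l then 1 else 0) := by
    refine ⟨fun i => by split_ifs <;> simp, fun i => by split_ifs <;> simp, ?_, fun S => ?_⟩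
    · intro i j h
      dsimp only
      split_ifs <;> first | omega | simp
    · rw [sum_boole, sum_boole]
      norm_cast
      have h1 : {i ∈ range #S | i < l} = range (min #S l) := by
        ext i; simp
      rw [h1, card_range]
      refine le_min (card_filter_le _ _) ((card_le_card (t := range l') fun i hi => ?_).trans ?_)
      · simp only [mem_filter] at hi; exact mem_range.2 hi.2
      · simpa using hl
  convert inv hind hp using 2 <;> split_ifs <;> simp

theorem node (hp : DomS p' p) : DomS (fun i => nodeSeries (p' i)) (fun i => nodeSeries (p i)) :=
  hp.X_sq_mul.derivative.mul hp.inv_one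

/-- The constant terms of `u` contribute to `nodeSeries u` independently of the other terms. -/
theorem node_sub {c' c : ℕ → ℕ} (hp : DomS p' p)
    (hc' : ∀ i, coeff 0 (p' i) = c' i) (hc : ∀ i, coeff 0 (p i) = c i) :
    DomS (fun i => nodeSeries (p' i) - nodeSeries (C (c' i : ℚ)))
      (fun i => nodeSeries (p i) - nodeSeries (C (c i : ℚ))) := by
  have hC : DomS (fun i => C (c' i : ℚ)) (fun i => C (c i : ℚ)) := fun k => by
    simp only [coeff_C]
    split_ifs
    · simpa only [hc', hc] using hp 0
    · exact Dom.zero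
  have hv : DomS (fun i => p' i - C (c' i : ℚ)) (fun i => p i - C (c i : ℚ)) := fun k => by
    simp only [map_sub, coeff_C]
    split_ifs with h
    · subst h
      simp only [hc', hc, sub_self]
      exact Dom.zero
    · simpa using hp k
  -- With `v` the constant term of `u`, the difference is rewritten without subtraction except in `u
  -- - v`, which is itself dominated.
  have split : ∀ u v : ℚ⟦X⟧, nodeSeries u - nodeSeries v =
      d⁄dX ℚ (X ^ 2 * v) * ((1 - X ^ 2 * v)⁻¹ * (X ^ 2 * (u - v) * (1 - X ^ 2 * u)⁻¹)) +
        d⁄dX ℚ (X ^ 2 * (u - v)) * (1 - X ^ 2 * u)⁻¹ := by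
    intro u v
    have h1 := one_sub_mul_inv u
    have h2 := one_sub_mul_inv v
    have h3 : (1 - X ^ 2 * u)⁻¹ - (1 - X ^ 2 * v)⁻¹ =
        (1 - X ^ 2 * v)⁻¹ * (X ^ 2 * (u - v) * (1 - X ^ 2 * u)⁻¹) := by
      linear_combination (-(1 - X ^ 2 * u)⁻¹) * h2 + (1 - X ^ 2 * v)⁻¹ * h1
    rw [← h3, mul_sub (X ^ 2) u v, map_sub, nodeSeries, nodeSeries]
    ring
  simp only [split]
  exact (hC.X_sq_mul.derivative.mul (hC.inv_one.mul (hv.X_sq_mul.mul hp.inv_one))).add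
    (hv.X_sq_mul.derivative.mul hp.inv_one)

end DomS

/-- This is the number of closed walks of length `2 * k` in a star with `c` leaves. -/
theorem coeff_nodeSeries_C (c : ℚ) {k : ℕ} (hk : 1 ≤ k) :
    coeff (2 * k - 1) (nodeSeries (C c)) = 2 * c ^ k := by
  have h : nodeSeries (C c) = X * (C (2 * c) * (1 - X ^ 2 * C c)⁻¹) := by
    have : d⁄dX ℚ (X ^ 2 * C c) = X * C (2 * c) := by
      ext n
      rw [coeff_derivative, coeff_mul_C, coeff_X_pow, coeff_mul_C, coeff_X]
      rcases n with _ | _ | n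
      · norm_num
      · norm_num [mul_comm]
      · simp
    rw [nodeSeries, this, mul_assoc]
  have h2 : ∀ k, coeff (2 * k) (1 - X ^ 2 * C c)⁻¹ = c ^ k := by
    intro k
    induction k with
    | zero => simp
    | succ k ih =>
      rw [inv_eq_one_add, map_add, show 2 * (k + 1) = 2 * k + 2 by ring, coeff_X_pow_mul,
        coeff_C_mul, ih]
      simp [pow_succ']
  obtain ⟨k, rfl⟩ := Nat.exists_eq_add_of_le' hk
  rw [h, show 2 * (k + 1) - 1 = 2 * k + 1 by omega, coeff_succ_X_mul, coeff_C_mul, h2, pow_succ']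
  ring

/-- Adding the contributions of two vertices joined by an edge. -/
theorem nodeSeries_inv_add (u v : ℚ⟦X⟧) :
    nodeSeries ((1 - X ^ 2 * u)⁻¹ + v) =
      nodeSeries v + nodeSeries ((1 - X ^ 2 * v)⁻¹ * (1 - X ^ 2 * u)⁻¹) := by
  set f := (1 - X ^ 2 * u)⁻¹
  set g := (1 - X ^ 2 * v)⁻¹ with hg
  have h2 : (1 - X ^ 2 * v) * g = 1 := one_sub_mul_inv v
  set w := (1 - X ^ 2 * (g * f))⁻¹ with hw
  have h3 : (1 - X ^ 2 * (g * f)) * w = 1 := one_sub_mul_inv _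
  -- This factorization carries the lemma: the logarithmic derivative turns the product into a sum.
  have h4 : (1 - X ^ 2 * (f + v)) = (1 - X ^ 2 * v) * (1 - X ^ 2 * (g * f)) := by
    linear_combination (X ^ 2 * f) * h2
  have h5 : (1 - X ^ 2 * (f + v))⁻¹ = g * w := by
    refine (eq_inv_of_mul_eq_one ?_).symm
    rw [h4]
    linear_combination (1 - X ^ 2 * (g * f)) * w * h2 + h3
  have h6 : d⁄dX ℚ (X ^ 2 * (f + v)) = d⁄dX ℚ (X ^ 2 * v) * (1 - X ^ 2 * (g * f)) +
      (1 - X ^ 2 * v) * d⁄dX ℚ (X ^ 2 * (g * f)) := by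
    have h7 : X ^ 2 * (f + v) = 1 - (1 - X ^ 2 * v) * (1 - X ^ 2 * (g * f)) := by
      rw [← h4]; ring
    rw [h7, map_sub, Derivation.leibniz, map_sub, map_sub]
    simp only [smul_eq_mul, Derivation.map_one_eq_zero]
    ring
  unfold nodeSeries
  rw [h5, h6, ← hg, ← hw]
  linear_combination (d⁄dX ℚ (X ^ 2 * v) * g) * h3 + (w * d⁄dX ℚ (X ^ 2 * (g * f))) * h2

end GreedyWalks

/-! ### Plane forests and their levels. -/

namespace GreedyWalks

open Finset PowerSeries

/-- Plane forests: `cons c s` has a first tree whose root has the child forest `c`, and `s` is the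
forest of the remaining trees. A tree is identified with the child forest of its root. -/
inductive Forest where
  | nil : Forest
  | cons (c s : Forest) : Forest

namespace Forest

/-- The number of trees. -/
def len : Forest → ℕ
  | nil => 0
  | cons _ s => len s + 1

/-- The trees of one forest followed by those of another one. -/
def append : Forest → Forest → Forest
  | nil, G => G
  | cons c s, G => cons c (append s G)

/-- The forest that remains when all roots are removed. -/
def down : Forest → Forest
  | nil => nil
  | cons c s => append c (down s)

/-- The sum of `g` over the child forests of all vertices. -/
def acc {M : Type*} [AddCommMonoid M] (g : Forest → M) : Forest → M
  | nil => 0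
  | cons c s => g c + acc g c + acc g s

/-- The numbers of children of the roots. -/
def counts : Forest → List ℕ
  | nil => []
  | cons c s => len c :: counts s

/-- The numbers of children of the vertices at a given level. -/
def lev : ℕ → Forest → List ℕ
  | 0, F => counts F
  | j + 1, F => lev j (down F)

/-- The child forest of a given root. -/
def kid : Forest → ℕ → Forest
  | nil, _ => nil
  | cons c _, 0 => c
  | cons _ s, i + 1 => kid s i

/-- The sum of the generating functions of closed walks based at the roots. -/
noncomputable def walkSum : Forest → ℚ⟦X⟧
  | nil => 0
  | cons c s => (1 - X ^ 2 * walkSum c)⁻¹ + walkSum s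

/-- The generating function of closed walks based at a given root. -/
noncomputable def val (F : Forest) (i : ℕ) : ℚ⟦X⟧ :=
  if i < len F then (1 - X ^ 2 * walkSum (kid F i))⁻¹ else 0

/-- The number of vertices. -/
def size : Forest → ℕ := acc fun _ => 1

/-- The numbers of children of all vertices. -/
def nodes : Forest → Multiset ℕ := acc fun c => {len c}

section Basic

variable {M : Type*} [AddCommMonoid M] (g : Forest → M)

@[simp] theorem len_append (F G : Forest) : len (append F G) = len F + len G := by
  induction F with
  | nil => simp [append, len]
  | cons c s _ ih => simp [append, len, ih]; omega

@[simp] theorem acc_append (F G : Forest) : acc g (append F G) = acc g F + acc g G := by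
  induction F with
  | nil => simp [append, acc]
  | cons c s _ ih => simp [append, acc, ih, add_assoc]

theorem append_assoc (F G K : Forest) : append (append F G) K = append F (append G K) := by
  induction F with
  | nil => rfl
  | cons c s _ ih => simp [append, ih]

@[simp] theorem append_nil (F : Forest) : append F nil = F := by
  induction F with
  | nil => rfl
  | cons c s _ ih => simp [append, ih]

theorem down_append (F G : Forest) : down (append F G) = append (down F) (down G) := by
  induction F with
  | nil => rfl
  | cons c s _ ih => simp [append, down, ih, append_assoc]

theorem counts_append (F G : Forest) : counts (append F G) = counts F ++ counts G := by
  induction F with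
  | nil => rfl
  | cons c s _ ih => simp [append, counts, ih]

theorem lev_append (j : ℕ) (F G : Forest) : lev j (append F G) = lev j F ++ lev j G := by
  induction j generalizing F G with
  | zero => exact counts_append F G
  | succ j ih => simp [lev, down_append, ih]

theorem length_counts (F : Forest) : (counts F).length = len F := by
  induction F with
  | nil => rfl
  | cons c s _ ih => simp [counts, len, ih]

theorem sum_counts (F : Forest) : (counts F).sum = len (down F) := by
  induction F with
  | nil => rfl
  | cons c s _ ih => simp [counts, down, ih]

theorem length_lev_succ (j : ℕ) (F : Forest) : (lev (j + 1) F).length = (lev j F).sum := by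
  induction j generalizing F with
  | zero => simp [lev, length_counts, sum_counts]
  | succ j ih => exact ih (down F)

theorem lev_cons (j : ℕ) (c s : Forest) : lev j (cons c s) = lev j (cons c nil) ++ lev j s := by
  rw [← lev_append]; rfl

theorem lev_succ_single (j : ℕ) (c : Forest) : lev (j + 1) (cons c nil) = lev j c := by
  simp [lev, down]

theorem lev_nil (j : ℕ) : lev j nil = [] := by
  induction j with
  | zero => rfl
  | succ j ih => simpa [lev, down] using ih

theorem counts_getD (F : Forest) (i : ℕ) : (counts F).getD i 0 = len (kid F i) := by
  induction F generalizing i with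
  | nil => simp [counts, kid, len]
  | cons c s _ ih =>
    rcases i with _ | i
    · simp [counts, kid]
    · simpa [counts, kid] using ih i

theorem acc_eq_sum_add (F : Forest) :
    acc g F = ∑ i ∈ range (len F), g (kid F i) + acc g (down F) := by
  induction F with
  | nil => simp [acc, len, down]
  | cons c s _ ih =>
    simp only [acc, len, down, acc_append, sum_range_succ', kid, ih]
    abel

theorem val_append_left (F G : Forest) {i : ℕ} (hi : i < len F) :
    val (append F G) i = val F i := by
  have : kid (append F G) i = kid F i := by
    induction F generalizing i with
    | nil => simp [len] at hi
    | cons c s _ ih =>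
      rcases i with _ | i
      · rfl
      · exact ih (by simpa [len] using hi)
  rw [val, val, this, if_pos hi, if_pos (by simp; omega)]

theorem val_append_right (F G : Forest) (i : ℕ) :
    val (append F G) (len F + i) = val G i := by
  have : kid (append F G) (len F + i) = kid G i := by
    induction F generalizing i with
    | nil => simp [append, len]
    | cons c s _ ih =>
      rw [append, len, show len s + 1 + i = len s + i + 1 by omega, kid, ih]
  simp [val, this]

theorem walkSum_eq_sum (F : Forest) : walkSum F = ∑ i ∈ range (len F), val F i := by
  induction F with
  | nil => simp [walkSum, len]
  | cons c s _ ih =>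
    rw [walkSum, len, sum_range_succ', ih, add_comm]
    simp [val, len, kid]

/-- The children of the `i`-th root occupy consecutive positions in `down F`, after those of the
earlier roots. This is the block form required by `Dom.blocks`. -/
theorem walkSum_kid (F : Forest) (i : ℕ) :
    walkSum (kid F i) = ∑ j ∈ range (len (kid F i)),
      val (down F) (∑ m ∈ range i, len (kid F m) + j) := by
  induction F generalizing i with
  | nil => simp [kid, walkSum, len]
  | cons c s _ ih =>
    rcases i with _ | i
    · simp only [kid, range_zero, sum_empty, zero_add, down]
      rw [walkSum_eq_sum]
      exact sum_congr rfl fun j hj => (val_append_left _ _ (mem_range.1 hj)).symm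
    · simp only [kid, down]
      rw [ih]
      refine sum_congr rfl fun j _ => ?_
      rw [sum_range_succ', ← val_append_right c (down s)]
      congr 1
      simp [kid]; ring

theorem acc_congr {g g' : Forest → M} (h : ∀ c, g c = g' c) (F : Forest) : acc g F = acc g' F := by
  rw [funext h]

theorem map_acc {N : Type*} [AddCommMonoid N] (φ : M →+ N) (F : Forest) :
    φ (acc g F) = acc (fun c => φ (g c)) F := by
  induction F with
  | nil => simp [acc]
  | cons c s h1 h2 => simp [acc, h1, h2]

theorem size_eq (F : Forest) : size F = len F + size (down F) := by
  rw [size, acc_eq_sum_add]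
  simp

theorem nodes_eq (F : Forest) : nodes F = counts F + nodes (down F) := by
  induction F with
  | nil => simp [nodes, counts, acc, down]
  | cons c s _ ih =>
    simp only [nodes] at ih
    simp only [nodes, acc, counts, down, acc_append, ih, ← Multiset.cons_coe,
      ← Multiset.singleton_add]
    abel

theorem size_down_lt {F : Forest} (h : F ≠ nil) : size (down F) < size F := by
  rw [size_eq F]
  cases F with
  | nil => exact absurd rfl h
  | cons c s => simp [len]

end Basic

end Forest

/-! ### Majorization of multisets through excesses. -/

/-- The excess of a multiset of numbers over a threshold. -/
def excess (M : Multiset ℕ) (m : ℕ) : ℕ := (M.map (· - m)).sum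

@[simp] theorem excess_add (M N : Multiset ℕ) (m : ℕ) :
    excess (M + N) m = excess M m + excess N m := by simp [excess]

@[simp] theorem excess_cons (a : ℕ) (M : Multiset ℕ) (m : ℕ) :
    excess (a ::ₘ M) m = (a - m) + excess M m := by simp [excess]

@[simp] theorem excess_zero (M : Multiset ℕ) : excess M 0 = M.sum := by simp [excess]

theorem sum_le_card_mul_add_excess (M : Multiset ℕ) (m : ℕ) :
    M.sum ≤ M.card * m + excess M m := by
  induction M using Multiset.induction with
  | empty => simp
  | cons a M ih =>
    simp only [Multiset.sum_cons, Multiset.card_cons, excess_cons, add_mul]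
    omega

theorem excess_eq_zero {M : Multiset ℕ} {m : ℕ} (h : ∀ x ∈ M, x ≤ m) : excess M m = 0 := by
  rw [excess, Multiset.sum_eq_zero_iff]
  simp only [Multiset.mem_map]
  rintro _ ⟨x, hx, rfl⟩
  have := h x hx
  omega

theorem excess_le_of_le {M N : Multiset ℕ} (h : M ≤ N) (m : ℕ) : excess M m ≤ excess N m := by
  obtain ⟨K, rfl⟩ := Multiset.le_iff_exists_add.1 h
  simp

/-- For every threshold `m`, the sum of any `s` terms is at most `s * m` plus the excess over `m`.
For a sorted list the entry at position `s` is a threshold with equality, which turns excess bounds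
into bounds on partial sums. -/
theorem mul_add_excess_getD {l : List ℕ} (hl : l.Pairwise (· ≥ ·)) (s : ℕ) :
    s * l.getD s 0 + excess l (l.getD s 0) = ∑ i ∈ range s, l.getD i 0 := by
  induction l generalizing s with
  | nil => simp
  | cons x l ih =>
    rw [List.pairwise_cons] at hl
    rcases s with _ | s
    · simp only [List.getD_cons_zero, zero_mul, zero_add, range_zero, sum_empty]
      refine excess_eq_zero fun y hy => ?_
      rcases List.mem_cons.1 (Multiset.mem_coe.1 hy) with rfl | hy
      · exact le_rfl
      · exact hl.1 y hy
    · have h1 := ih hl.2 s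
      have h2 : l.getD s 0 ≤ x := by
        rcases lt_or_ge s l.length with h | h
        · rw [List.getD_eq_getElem _ _ h]
          exact hl.1 _ (List.getElem_mem h)
        · rw [List.getD_eq_default _ _ h]
          exact Nat.zero_le _
      rw [sum_range_succ', ← Multiset.cons_coe, excess_cons]
      simp only [List.getD_cons_succ, List.getD_cons_zero, ← h1]
      rw [add_mul]
      omega

theorem sum_le_sum_getD {l : List ℕ} (hl : l.Pairwise (· ≥ ·)) {M : Multiset ℕ}
    (h : ∀ m, excess M m ≤ excess l m) {s : ℕ} (hs : M.card ≤ s) :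
    M.sum ≤ ∑ i ∈ range s, l.getD i 0 := by
  rw [← mul_add_excess_getD hl]
  have h1 := sum_le_card_mul_add_excess M (l.getD s 0)
  have h2 := h (l.getD s 0)
  have h3 := Nat.mul_le_mul_right (l.getD s 0) hs
  omega

theorem antitone_getD {l : List ℕ} (hl : l.Pairwise (· ≥ ·)) : Antitone fun i => l.getD i 0 := by
  intro i j hij
  dsimp only
  rcases lt_or_ge j l.length with h | h
  · rw [List.getD_eq_getElem _ _ h, List.getD_eq_getElem _ _ (by omega)]
    rcases hij.eq_or_lt with rfl | hij
    · exact le_rfl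
    · exact List.pairwise_iff_getElem.1 hl i j (by omega) h hij
  · rw [List.getD_eq_default _ _ h]
    exact Nat.zero_le _

theorem sum_range_getD (f : ℕ → ℕ) (l : List ℕ) :
    ∑ i ∈ range l.length, f (l.getD i 0) = (l.map f).sum := by
  induction l with
  | nil => simp
  | cons x l ih =>
    rw [List.length_cons, sum_range_succ']
    simp only [List.getD_cons_succ, List.getD_cons_zero, ih, List.map_cons, List.sum_cons]
    omega

theorem sum_getD_le {l' l : List ℕ} (hl : l.Pairwise (· ≥ ·))
    (h : ∀ m, excess l' m ≤ excess l m) (S : Finset ℕ) :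
    ∑ i ∈ S, l'.getD i 0 ≤ ∑ i ∈ range #S, l.getD i 0 := by
  have key : ∀ m, excess (S.val.map fun i => l'.getD i 0) m ≤ excess l' m := by
    intro m
    have h1 : excess l' m = ∑ i ∈ range l'.length, (l'.getD i 0 - m) := by
      rw [excess, Multiset.map_coe, Multiset.sum_coe, sum_range_getD (· - m)]
    rw [excess, Multiset.map_map, h1]
    calc ∑ i ∈ S, (l'.getD i 0 - m) = ∑ i ∈ S with i < l'.length, (l'.getD i 0 - m) := by
          rw [sum_filter]
          refine sum_congr rfl fun i _ => ?_
          split_ifs with hi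
          · rfl
          · rw [List.getD_eq_default _ _ (by omega)]; omega
      _ ≤ _ := sum_le_sum_of_subset fun i hi => by
          simp only [mem_filter] at hi; exact mem_range.2 hi.2
  exact sum_le_sum_getD hl (fun m => (key m).trans (h m)) (by simp)

end GreedyWalks

/-! ### Sorted forests maximize the walk series. -/

namespace GreedyWalks

open Finset PowerSeries

theorem domS_single {u' u : ℚ⟦X⟧} (h0 : ∀ k, 0 ≤ coeff k u')
    (h : ∀ k, coeff k u' ≤ coeff k u) :
    DomS (fun i => if i = 0 then u' else 0) (fun i => if i = 0 then u else 0) := fun k => by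
  have h0' : ∀ k, 0 ≤ coeff k u := fun k => (h0 k).trans (h k)
  refine ⟨fun i => ?_, fun i => ?_, fun i j hij => ?_, fun S => ?_⟩
  · dsimp only; split_ifs <;> simp [h0]
  · dsimp only; split_ifs <;> simp [h0']
  · dsimp only; split_ifs <;> first | omega | simp [h0']
  · simp only [apply_ite (coeff k), map_zero, sum_ite_eq']
    rcases S.eq_empty_or_nonempty with rfl | hS
    · simp
    · rw [if_pos (mem_range.2 hS.card_pos)]
      split_ifs
      · exact h k
      · exact h0' k

theorem coeff_nodeSeries_mono {u' u : ℚ⟦X⟧}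
    (h : ∀ k, 0 ≤ coeff k u' ∧ coeff k u' ≤ coeff k u) (k : ℕ) :
    coeff k (nodeSeries u') ≤ coeff k (nodeSeries u) := by
  have := ((domS_single (fun k => (h k).1) fun k => (h k).2).node k).le {0}
  simpa using this

theorem coeff_inv_nonneg {u : ℚ⟦X⟧} (h : ∀ k, 0 ≤ coeff k u) (k : ℕ) :
    0 ≤ coeff k (1 - X ^ 2 * u)⁻¹ := by
  have := ((domS_single h fun k => le_rfl).inv_one k).nonneg 0
  simpa using this

theorem coeff_mul_mono {u' u v' v : ℚ⟦X⟧} {n : ℕ}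
    (hu : ∀ k ≤ n, 0 ≤ coeff k u' ∧ coeff k u' ≤ coeff k u)
    (hv : ∀ k ≤ n, 0 ≤ coeff k v' ∧ coeff k v' ≤ coeff k v) :
    0 ≤ coeff n (u' * v') ∧ coeff n (u' * v') ≤ coeff n (u * v) := by
  rw [coeff_mul, coeff_mul]
  constructor
  · refine sum_nonneg fun x hx => ?_
    have := mem_antidiagonal.1 hx
    exact mul_nonneg (hu _ (by omega)).1 (hv _ (by omega)).1
  · refine sum_le_sum fun x hx => ?_
    have := mem_antidiagonal.1 hx
    have h1 := hu x.1 (by omega)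
    have h2 := hv x.2 (by omega)
    exact mul_le_mul h1.2 h2.2 h2.1 (h1.1.trans h1.2)

/-- The product of two walk series is monotone in their sum and in the sum of their arguments. -/
theorem coeff_inv_mul_inv_mono {u' v' u v : ℚ⟦X⟧}
    (h0 : ∀ k, 0 ≤ coeff k (u' + v')) (h : ∀ k, coeff k (u' + v') ≤ coeff k (u + v))
    (hf0 : ∀ k, 0 ≤ coeff k ((1 - X ^ 2 * u')⁻¹ + (1 - X ^ 2 * v')⁻¹))
    (hf : ∀ k, coeff k ((1 - X ^ 2 * u')⁻¹ + (1 - X ^ 2 * v')⁻¹) ≤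
      coeff k ((1 - X ^ 2 * u)⁻¹ + (1 - X ^ 2 * v)⁻¹)) (k : ℕ) :
    0 ≤ coeff k ((1 - X ^ 2 * u')⁻¹ * (1 - X ^ 2 * v')⁻¹) ∧
      coeff k ((1 - X ^ 2 * u')⁻¹ * (1 - X ^ 2 * v')⁻¹) ≤
        coeff k ((1 - X ^ 2 * u)⁻¹ * (1 - X ^ 2 * v)⁻¹) := by
  have key : ∀ (a b : ℚ⟦X⟧) k, 2 * coeff k ((1 - X ^ 2 * a)⁻¹ * (1 - X ^ 2 * b)⁻¹) =
      coeff k ((1 - X ^ 2 * a)⁻¹ + (1 - X ^ 2 * b)⁻¹) +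
        if 2 ≤ k then coeff (k - 2) ((a + b) * ((1 - X ^ 2 * a)⁻¹ * (1 - X ^ 2 * b)⁻¹)) else 0 := by
    intro a b k
    -- Majorization alone does not control a product, since products of numbers favour balanced
    -- factors. This identity gives a recursion for the product that involves only the two sums.
    have : C (2 : ℚ) * ((1 - X ^ 2 * a)⁻¹ * (1 - X ^ 2 * b)⁻¹) =
        ((1 - X ^ 2 * a)⁻¹ + (1 - X ^ 2 * b)⁻¹) +
          X ^ 2 * ((a + b) * ((1 - X ^ 2 * a)⁻¹ * (1 - X ^ 2 * b)⁻¹)) := by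
      have h1 := one_sub_mul_inv a
      have h2 := one_sub_mul_inv b
      rw [show (C (2 : ℚ) : ℚ⟦X⟧) = 2 from map_ofNat C 2]
      linear_combination (1 - X ^ 2 * b)⁻¹ * h1 + (1 - X ^ 2 * a)⁻¹ * h2
    rw [← coeff_C_mul, this, map_add, coeff_X_pow_mul']
  induction k using Nat.strong_induction_on with
  | _ k ih =>
    have e' := key u' v' k
    have e := key u v k
    have := hf k
    have := hf0 k
    by_cases hk : 2 ≤ k
    · rw [if_pos hk] at e e'
      have := coeff_mul_mono (n := k - 2) (fun i _ => ⟨h0 i, h i⟩) fun i hi => ih i (by omega)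
      constructor <;> linarith
    · rw [if_neg hk] at e e'
      constructor <;> linarith

namespace Forest

theorem coeff_walkSum_nonneg (F : Forest) (k : ℕ) : 0 ≤ coeff k (walkSum F) := by
  induction F generalizing k with
  | nil => simp [walkSum]
  | cons c s h1 h2 =>
    rw [walkSum, map_add]
    exact add_nonneg (coeff_inv_nonneg h1 k) (h2 k)

/-- Every level is arranged by non-increasing numbers of children. -/
def Sorted (F : Forest) : Prop := ∀ j, (lev j F).Pairwise (· ≥ ·)

/-- The sum of the contributions of all vertices to the closed walk series. -/
noncomputable def walks : Forest → ℚ⟦X⟧ := acc fun c => nodeSeries (walkSum c)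

/-- The part of `walks` that only depends on the numbers of children. -/
noncomputable def starWalks : Forest → ℚ⟦X⟧ := acc fun c => nodeSeries (C (len c : ℚ))

theorem Sorted.down {F : Forest} (h : Sorted F) : Sorted (down F) := fun j => h (j + 1)

theorem coeff_zero_walkSum (F : Forest) : coeff 0 (walkSum F) = len F := by
  induction F with
  | nil => simp [walkSum, len]
  | cons c s _ ih =>
    rw [walkSum, map_add, ih, len]
    simp; ring

theorem blocks_walkSum {F' F : Forest}
    (hc : Antitone fun i => len (kid F i))
    (hle : ∀ S : Finset ℕ, ∑ i ∈ S, len (kid F' i) ≤ ∑ i ∈ range #S, len (kid F i))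
    (h : DomS (val (down F')) (val (down F))) :
    DomS (fun i => walkSum (kid F' i)) (fun i => walkSum (kid F i)) := fun k => by
  simp only [walkSum_kid, map_sum]
  exact (h k).blocks hc hle

theorem coeff_sum_range_le {p' p : ℕ → ℚ⟦X⟧} (h : DomS p' p) {l' l : ℕ} (hl : l' ≤ l) (k : ℕ) :
    coeff k (∑ i ∈ range l', p' i) ≤ coeff k (∑ i ∈ range l, p i) := by
  rw [map_sum, map_sum]
  refine ((h k).le _).trans ?_
  rw [card_range]
  exact sum_le_sum_of_subset_of_nonneg (range_subset_range.2 hl) fun _ _ _ => (h k).nonneg _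

/-- Sorted forests have the most closed walks. -/
theorem walks_le_of_sorted {F' F : Forest} (hF : Sorted F) (hlen : len F' ≤ len F)
    (hlev : ∀ j m, excess (lev j F') m ≤ excess (lev j F) m) :
    DomS (val F') (val F) ∧
      (∀ k, coeff k (walks F' - starWalks F') ≤ coeff k (walks F - starWalks F)) ∧
      ∀ k, coeff k (starWalks F') ≤ coeff k (starWalks F) := by
  induction hn : size F' + size F using Nat.strong_induction_on generalizing F' F with
  | _ n ih =>
  by_cases hnil : F' = nil ∧ F = nil
  · obtain ⟨rfl, rfl⟩ := hnil
    refine ⟨fun k => ?_, fun k => le_rfl, fun k => le_rfl⟩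
    simpa [val, len] using Dom.zero
  have hsize : size (Forest.down F') + size (Forest.down F) < n := by
    have h1 := size_eq F'
    have h2 := size_eq F
    rcases not_and_or.1 hnil with h | h
    · have := size_down_lt h; omega
    · have := size_down_lt h; omega
  have hdlen : len (Forest.down F') ≤ len (Forest.down F) := by
    have := hlev 0 0
    simpa [lev, sum_counts] using this
  -- The induction removes all roots: the number of vertices on the next level is the sum of the
  -- child counts, that is, the excess over `0`.
  obtain ⟨ihv, ihw, ihs⟩ := ih _ hsize hF.down hdlen (fun j m => hlev (j + 1) m) rfl
  have hanti : Antitone fun i => len (kid F i) := by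
    simpa only [lev, counts_getD] using antitone_getD (hF 0)
  have hle : ∀ S : Finset ℕ, ∑ i ∈ S, len (kid F' i) ≤ ∑ i ∈ range #S, len (kid F i) := by
    intro S
    have := sum_getD_le (hF 0) (hlev 0) S
    simpa only [lev, counts_getD] using this
  have hu := blocks_walkSum hanti hle ihv
  have hCD : DomS (fun i => C (len (kid F' i) : ℚ)) (fun i => C (len (kid F i) : ℚ)) := fun k => by
    simp only [coeff_C]
    split_ifs
    · exact Dom.natCast hanti hle
    · exact Dom.zero
  refine ⟨hu.inv_cutoff hlen, fun k => ?_, fun k => ?_⟩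
  · have e : ∀ G : Forest, walks G - starWalks G =
        ∑ i ∈ range (len G), (nodeSeries (walkSum (kid G i)) - nodeSeries (C (len (kid G i) : ℚ))) +
          (walks (Forest.down G) - starWalks (Forest.down G)) := by
      intro G
      rw [walks, starWalks, acc_eq_sum_add, acc_eq_sum_add (fun c => nodeSeries (C (len c : ℚ))),
        sum_sub_distrib]
      ring
    rw [e F', e F, map_add, map_add]
    exact add_le_add (coeff_sum_range_le (hu.node_sub (fun i => coeff_zero_walkSum _)
      fun i => coeff_zero_walkSum _) hlen k) (ihw k)
  · rw [starWalks, acc_eq_sum_add, acc_eq_sum_add _ F, map_add, map_add]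
    exact add_le_add (coeff_sum_range_le hCD.node hlen k) (ihs k)

/-- The closed walk series of a tree whose root has the child forest `F`. -/
noncomputable def treeWalks (F : Forest) : ℚ⟦X⟧ := walks (cons F nil)

/-- The part of the walk series that comes from the edge between the roots of two trees. -/
noncomputable def edgeWalks (c s : Forest) : ℚ⟦X⟧ :=
  nodeSeries ((1 - X ^ 2 * walkSum s)⁻¹ * (1 - X ^ 2 * walkSum c)⁻¹)

/-- Cutting the edge from the root to its first child leaves the trees over `s` and `c`; this lets
the levels be measured from that edge instead of from the root. -/
theorem treeWalks_cons (c s : Forest) :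
    treeWalks (cons c s) = walks (cons s (cons c nil)) + edgeWalks c s := by
  simp only [treeWalks, walks, acc, walkSum, nodeSeries_inv_add, edgeWalks]
  ring

/-- The degrees of the vertices of the tree whose root has the child forest `F`. -/
def degs (F : Forest) : Multiset ℕ := len F ::ₘ (nodes F).map (· + 1)

theorem degs_cons (c s : Forest) :
    degs (cons c s) = (nodes (cons s (cons c nil))).map (· + 1) := by
  simp only [degs, nodes, acc, len, Multiset.map_add, Multiset.map_singleton, Multiset.map_zero,
    ← Multiset.singleton_add]
  abel

/-- Sorting the levels of a tree, where levels are given by the distance to an edge, does not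
decrease the number of closed walks. -/
theorem edgeWalks_le_of_sorted {c' s' c s : Forest} (hF : Sorted (cons s (cons c nil)))
    (hlev : ∀ j m, excess (lev j (cons s' (cons c' nil))) m ≤
      excess (lev j (cons s (cons c nil))) m) (k : ℕ) :
    coeff k (edgeWalks c' s') ≤ coeff k (edgeWalks c s) := by
  have hv := (walks_le_of_sorted hF (by simp [len]) hlev).1
  have hd := (walks_le_of_sorted hF.down
    (by have := hlev 0 0; simpa [lev, sum_counts] using this)
    fun j m => hlev (j + 1) m).1
  have hdl : len (Forest.down (cons s' (cons c' nil))) ≤ len (Forest.down (cons s (cons c nil))) := by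
    have := hlev 0 0; simpa [lev, sum_counts] using this
  -- Only sums over both halves are comparable; the forests without their two roots supply the sum
  -- of the arguments.
  have hu : ∀ k, coeff k (walkSum s' + walkSum c') ≤ coeff k (walkSum s + walkSum c) := by
    intro k
    have := coeff_sum_range_le hd hdl k
    rw [← walkSum_eq_sum, ← walkSum_eq_sum] at this
    have e : ∀ s c, walkSum (Forest.down (cons s (cons c nil))) = walkSum s + walkSum c := by
      intro s c
      have happ : ∀ A B : Forest, walkSum (append A B) = walkSum A + walkSum B := by
        intro A B
        induction A with
        | nil => simp [append, walkSum]
        | cons x y _ ih => simp [append, walkSum, ih, add_assoc]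
      simp [Forest.down, happ]
    rwa [e, e] at this
  have hf : ∀ k, coeff k ((1 - X ^ 2 * walkSum s')⁻¹ + (1 - X ^ 2 * walkSum c')⁻¹) ≤
      coeff k ((1 - X ^ 2 * walkSum s)⁻¹ + (1 - X ^ 2 * walkSum c)⁻¹) := by
    intro k
    have := coeff_sum_range_le hv (l' := len (cons s' (cons c' nil)))
      (l := len (cons s (cons c nil))) (by simp [len]) k
    rw [← walkSum_eq_sum, ← walkSum_eq_sum] at this
    simpa [walkSum] using this
  refine coeff_nodeSeries_mono (coeff_inv_mul_inv_mono (fun k => ?_) hu (fun k => ?_) hf) k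
  · rw [map_add]
    exact add_nonneg (coeff_walkSum_nonneg _ _) (coeff_walkSum_nonneg _ _)
  · rw [map_add]
    exact add_nonneg (coeff_inv_nonneg (coeff_walkSum_nonneg _) _)
      (coeff_inv_nonneg (coeff_walkSum_nonneg _) _)

end Forest

end GreedyWalks

/-! ### Rearranging a tree into ordered form. -/

namespace GreedyWalks

open Finset PowerSeries

namespace Forest

theorem eq_nil_of_len_eq_zero {F : Forest} (h : len F = 0) : F = nil := by
  cases F with
  | nil => rfl
  | cons c s => simp [len] at h

theorem exists_append_of_le_len {G : Forest} {x : ℕ} (h : x ≤ len G) :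
    ∃ A B, G = append A B ∧ len A = x := by
  induction G generalizing x with
  | nil => exact ⟨nil, nil, rfl, by simp [len] at h ⊢; omega⟩
  | cons c s _ ih =>
    rcases x with _ | x
    · exact ⟨nil, cons c s, rfl, rfl⟩
    · obtain ⟨A, B, rfl, hA⟩ := ih (x := x) (by simp [len] at h; omega)
      exact ⟨cons c A, B, rfl, by simp [len, hA]⟩

theorem exists_counts_down {l : List ℕ} {G : Forest} (h : l.sum = len G) :
    ∃ F, counts F = l ∧ down F = G := by
  induction l generalizing G with
  | nil => exact ⟨nil, rfl, (eq_nil_of_len_eq_zero (by simpa using h.symm)).symm⟩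
  | cons x l ih =>
    rw [List.sum_cons] at h
    obtain ⟨A, B, rfl, hA⟩ := exists_append_of_le_len (G := G) (x := x) (by omega)
    obtain ⟨F, hF, hd⟩ := ih (G := B) (by simp [hA] at h; omega)
    exact ⟨cons A F, by simp [counts, hA, hF], by simp [down, hd]⟩

/-- Built from the bottom: the only constraint is that each level has as many vertices as the
previous one has children, so each level may be sorted independently. -/
theorem exists_sorted {X : ℕ → Multiset ℕ} (hX : ∀ j, (X (j + 1)).card = (X j).sum) {N : ℕ}
    (hN : X N = 0) : ∃ F, Sorted F ∧ ∀ j, (lev j F : Multiset ℕ) = X j := by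
  induction N generalizing X with
  | zero =>
    have h0 : ∀ j, X j = 0 := by
      intro j
      induction j with
      | zero => exact hN
      | succ j ih => rw [← Multiset.card_eq_zero, hX, ih, Multiset.sum_zero]
    exact ⟨nil, fun j => by simp [lev_nil], fun j => by simp [lev_nil, h0]⟩
  | succ N ih =>
    obtain ⟨G, hG, hlev⟩ := ih (X := fun j => X (j + 1)) (fun j => hX _) hN
    obtain ⟨F, hc, rfl⟩ := exists_counts_down (l := (X 0).sort (· ≥ ·)) (G := G) (by
      rw [← Multiset.sum_coe, Multiset.sort_eq, ← hX, ← hlev 0]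
      simp [lev, length_counts])
    refine ⟨F, fun j => ?_, fun j => ?_⟩
    · rcases j with _ | j
      · rw [lev, hc]
        exact Multiset.pairwise_sort _ _
      · exact hG j
    · rcases j with _ | j
      · rw [lev, hc, Multiset.sort_eq]
      · exact hlev j

theorem lev_eq_nil_of_size_le {F : Forest} {N : ℕ} (h : size F ≤ N) : lev N F = [] := by
  induction N generalizing F with
  | zero =>
    have := size_eq F
    rw [eq_nil_of_len_eq_zero (F := F) (by omega), lev_nil]
  | succ N ih =>
    rcases eq_or_ne F nil with rfl | hF
    · exact lev_nil _
    · have := size_down_lt hF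
      exact ih (F := down F) (by omega)

theorem nodes_eq_sum_lev {F : Forest} {N : ℕ} (h : size F ≤ N) :
    nodes F = ∑ j ∈ range N, (lev j F : Multiset ℕ) := by
  induction N generalizing F with
  | zero =>
    have := size_eq F
    rw [eq_nil_of_len_eq_zero (F := F) (by omega)]
    simp [nodes, acc]
  | succ N ih =>
    rcases eq_or_ne F nil with rfl | hF
    · simp [nodes, acc, lev_nil]
    · have := size_down_lt hF
      rw [nodes_eq, ih (F := down F) (by omega), sum_range_succ', add_comm]
      rfl

theorem card_nodes (F : Forest) : (nodes F).card = size F := by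
  have := map_acc (fun c => ({len c} : Multiset ℕ)) Multiset.cardHom F
  simpa [nodes, size] using this

theorem size_eq_sum_length {F : Forest} {N : ℕ} (h : size F ≤ N) :
    size F = ∑ j ∈ range N, (lev j F).length := by
  have := congrArg Multiset.card (nodes_eq_sum_lev h)
  rw [card_nodes, Multiset.card_sum] at this
  simpa using this

/-- The sum over all vertices of the number of vertices on the path to the root. -/
def depthSum : Forest → ℕ := acc fun c => size c + 1

theorem depthSum_eq (F : Forest) : depthSum F = size F + depthSum (down F) := by
  induction F with
  | nil => simp [depthSum, size, acc, down]
  | cons c s _ ih =>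
    simp only [depthSum, size] at ih
    simp only [depthSum, acc, size, down, acc_append, ih]
    omega

theorem len_eq_length_lev (F : Forest) : len F = (lev 0 F).length := (length_counts F).symm

theorem size_depthSum_congr {F G : Forest} (h : ∀ j, (lev j F).length = (lev j G).length) :
    size F = size G ∧ depthSum F = depthSum G := by
  induction hn : size F + size G using Nat.strong_induction_on generalizing F G with
  | _ n ih =>
  by_cases hnil : F = nil ∧ G = nil
  · rw [hnil.1, hnil.2]; exact ⟨rfl, rfl⟩
  have hsize : size (down F) + size (down G) < n := by
    have h1 := size_eq F
    have h2 := size_eq G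
    rcases not_and_or.1 hnil with h | h
    · have := size_down_lt h; omega
    · have := size_down_lt h; omega
  have h1 := ih _ hsize (fun j => h (j + 1)) rfl
  have h2 := size_eq F
  have h3 := size_eq G
  have h4 := depthSum_eq F
  have h5 := depthSum_eq G
  have h6 := h 0
  rw [← len_eq_length_lev, ← len_eq_length_lev] at h6
  omega

theorem nodes_congr {F G : Forest} (h : ∀ j, (lev j F : Multiset ℕ) = lev j G) :
    nodes F = nodes G := by
  rw [nodes_eq_sum_lev (le_max_left (size F) (size G)),
    nodes_eq_sum_lev (le_max_right (size F) (size G))]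
  exact sum_congr rfl fun j _ => h j

theorem card_lev_succ (j : ℕ) (F : Forest) :
    (lev (j + 1) F : Multiset ℕ).card = (lev j F : Multiset ℕ).sum := by
  simp [length_lev_succ]

theorem exists_sorted_rearrangement (F : Forest) :
    ∃ G, Sorted G ∧ ∀ j, (lev j G : Multiset ℕ) = lev j F :=
  exists_sorted (N := size F) (fun j => card_lev_succ j F)
    (by simp [lev_eq_nil_of_size_le le_rfl])

/-- Moving one child from a vertex to another one at the same level. -/
theorem exists_sorted_transfer {F : Forest} {j a b : ℕ}
    (h : {a, b} ≤ (lev j F : Multiset ℕ)) (hb : 1 ≤ b) :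
    ∃ G, Sorted G ∧ len G = len F ∧ (∀ i ≠ j, (lev i G : Multiset ℕ) = lev i F) ∧
      (lev j G : Multiset ℕ) + {a, b} = lev j F + {a + 1, b - 1} := by
  obtain ⟨K, hK⟩ := Multiset.le_iff_exists_add.1 h
  -- The transfer preserves both the size and the sum of level `j`, so all other levels can be kept.
  let X : ℕ → Multiset ℕ := fun i => if i = j then K + {a + 1, b - 1} else lev i F
  have hcard : ∀ i, (X i).card = (lev i F : Multiset ℕ).card := by
    intro i
    by_cases hi : i = j
    · subst hi; simp [X, hK, add_comm]
    · simp [X, hi]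
  have hsum : ∀ i, (X i).sum = (lev i F : Multiset ℕ).sum := by
    intro i
    by_cases hi : i = j
    · subst hi
      rw [hK]
      simp [X]
      omega
    · simp [X, hi]
  obtain ⟨G, hG, hlev⟩ := exists_sorted (X := X) (N := size F)
    (fun i => by rw [hcard, hsum, card_lev_succ])
    (by rw [← Multiset.card_eq_zero, hcard, lev_eq_nil_of_size_le le_rfl]; simp)
  refine ⟨G, hG, ?_, fun i hi => by simp [hlev, X, hi], ?_⟩
  · rw [len_eq_length_lev, len_eq_length_lev, ← Multiset.coe_card, hlev, hcard, Multiset.coe_card]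
  · rw [hlev, hK]
    simp only [X, if_true]
    abel

theorem eq_cons_nil_of_len {F : Forest} (h : len F = 1) : ∃ c, F = cons c nil := by
  cases F with
  | nil => simp [len] at h
  | cons c s => exact ⟨c, by rw [eq_nil_of_len_eq_zero (F := s) (by simpa [len] using h)]⟩

theorem eq_cons_cons_nil_of_len {F : Forest} (h : len F = 2) :
    ∃ s c, F = cons s (cons c nil) := by
  cases F with
  | nil => simp [len] at h
  | cons s F =>
    obtain ⟨c, rfl⟩ := eq_cons_nil_of_len (F := F) (by simpa [len] using h)
    exact ⟨s, c, rfl⟩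

theorem len_congr {F G : Forest} (h : (lev 0 F : Multiset ℕ) = lev 0 G) : len F = len G := by
  rw [len_eq_length_lev, len_eq_length_lev, ← Multiset.coe_card, h, Multiset.coe_card]

theorem coeff_walks_le {F' F : Forest} (hF : Sorted F) (hlen : len F' ≤ len F)
    (hlev : ∀ j m, excess (lev j F') m ≤ excess (lev j F) m) (k : ℕ) :
    coeff k (walks F') ≤ coeff k (walks F) := by
  obtain ⟨-, h1, h2⟩ := walks_le_of_sorted hF hlen hlev
  have h3 := h1 k
  have h4 := h2 k
  rw [map_sub, map_sub] at h3
  linarith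

theorem exists_sorted_tree (F : Forest) : ∃ G, Sorted (cons G nil) ∧
    (∀ j, (lev j G : Multiset ℕ) = lev j F) ∧ len G = len F ∧
      ∀ k, coeff k (treeWalks F) ≤ coeff k (treeWalks G) := by
  obtain ⟨G', hG, hlev⟩ := exists_sorted_rearrangement (cons F nil)
  obtain ⟨G, rfl⟩ := eq_cons_nil_of_len (F := G') (by rw [len_congr (hlev 0)]; rfl)
  refine ⟨G, hG, fun j => ?_, ?_, coeff_walks_le hG le_rfl fun j m => (by rw [hlev])⟩
  · rw [← lev_succ_single j G, ← lev_succ_single j F, hlev]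
  · simpa [lev, counts] using hlev 0

theorem degs_congr {F G : Forest} (h : ∀ j, (lev j F : Multiset ℕ) = lev j G) :
    degs F = degs G := by
  rw [degs, degs, nodes_congr h, len_congr (h 0)]

/-- If the vertices of the first tree on some level are all childless, sortedness forces the same on
the vertices to their right. -/
theorem lev_first_eq_nil {c s : Forest} (h : Sorted (cons c s)) {j : ℕ}
    (hj : lev j (cons c nil) = []) : lev j s = [] := by
  induction j with
  | zero => simp [lev, counts] at hj
  | succ j ih =>
    have h1 := length_lev_succ j (cons c nil)
    have h2 := length_lev_succ j s
    rw [hj] at h1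
    rw [← List.length_eq_zero_iff, h2]
    by_cases hn : lev j (cons c nil) = []
    · simp [ih hn]
    · obtain ⟨x, hx⟩ := List.exists_mem_of_ne_nil _ hn
      have hx0 : x = 0 := List.sum_eq_zero_iff.1 h1.symm x hx
      have := h j
      rw [lev_cons, List.pairwise_append] at this
      rw [List.sum_eq_zero_iff]
      intro y hy
      have := this.2.2 x hx y hy
      omega

/-- The degrees of the vertices at a given distance from the root of a tree. -/
def dlev : ℕ → Forest → List ℕ
  | 0, F => [len F]
  | j + 1, F => (lev j F).map (· + 1)

/-- The degrees are non-increasing along each level and from one level to the next. -/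
structure Ordered (F : Forest) : Prop where
  sorted : Sorted (cons F nil)
  le : ∀ j, ∀ x ∈ dlev j F, ∀ y ∈ dlev (j + 1) F, y ≤ x

/-- Level `j` around the first edge splits into root level `j` outside the first branch and root
level `j + 1` inside it. Comparing the two halves, combined with sortedness along root levels,
therefore compares consecutive root levels. -/
theorem ordered_of_separated {c s : Forest} (h : Sorted (cons (cons c s) nil))
    (hne : ∀ j, lev j (cons s nil) = [] → lev j (cons c nil) = [])
    (hsep : ∀ j, ∀ x ∈ lev j (cons s nil), ∀ y ∈ lev j (cons c nil), y ≤ x) :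
    Ordered (cons c s) := by
  have h' : Sorted (cons c s) := fun j => by
    have := h (j + 1)
    rwa [lev_succ_single] at this
  have hcs : ∀ j, ∀ x ∈ lev j (cons c nil), ∀ y ∈ lev j s, y ≤ x := by
    intro j
    have := h' j
    rw [lev_cons, List.pairwise_append] at this
    exact this.2.2
  refine ⟨h, fun j x hx y hy => ?_⟩
  rcases j with _ | j
  · simp only [dlev, lev, counts, List.map_cons, List.mem_cons, List.mem_map, len,
      List.not_mem_nil, or_false] at hx hy
    have h1 := hsep 0 (len s) (by simp [lev, counts]) (len c) (by simp [lev, counts])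
    rcases hy with rfl | ⟨y, hy, rfl⟩
    · omega
    · have := hcs 0 (len c) (by simp [lev, counts]) y hy
      omega
  · simp only [dlev, List.mem_map] at hx hy
    obtain ⟨x, hx, rfl⟩ := hx
    obtain ⟨y, hy, rfl⟩ := hy
    have key : ∀ z ∈ lev (j + 1) (cons c nil), z ≤ x := by
      intro z hz
      rw [lev_cons, List.mem_append] at hx
      rcases hx with hx | hx
      · have : lev (j + 1) (cons s nil) ≠ [] := fun h0 => by simp [hne _ h0] at hz
        obtain ⟨w, hw⟩ := List.exists_mem_of_ne_nil _ this
        refine (hsep _ w hw z hz).trans (hcs j x hx w ?_)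
        rwa [lev_succ_single] at hw
      · exact hsep (j + 1) x (by rwa [lev_succ_single]) z hz
    rw [lev_cons, List.mem_append] at hy
    have : y ≤ x := by
      rcases hy with hy | hy
      · exact key y hy
      · have : lev (j + 1) (cons c nil) ≠ [] := fun h0 => by
          simp [lev_first_eq_nil h' h0] at hy
        obtain ⟨w, hw⟩ := List.exists_mem_of_ne_nil _ this
        exact (hcs _ w hw y hy).trans (key w hw)
    omega

theorem sum_range_getD_append (l₁ l₂ : List ℕ) :
    ∑ i ∈ range l₁.length, (l₁ ++ l₂).getD i 0 = l₁.sum := by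
  have := sum_range_getD id l₁
  simp only [id_eq, List.map_id_fun] at this
  rw [← this]
  refine sum_congr rfl fun i hi => ?_
  rw [List.getD_append _ _ _ _ (mem_range.1 hi)]

/-- Sort the levels around the edge from the root to its first child, so that the half `s'`
containing the root takes the largest counts. If this half grows, the total depth drops; if its size
is unchanged, the two halves were already separated. -/
theorem exists_improvement {c s : Forest} (h : Sorted (cons (cons c s) nil)) :
    Ordered (cons c s) ∨ ∃ F, degs F = degs (cons c s) ∧ depthSum F < depthSum (cons c s) ∧
      ∀ k, coeff k (treeWalks (cons c s)) ≤ coeff k (treeWalks F) := by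
  obtain ⟨E, hE, hlev⟩ := exists_sorted_rearrangement (cons s (cons c nil))
  obtain ⟨s', c', rfl⟩ := eq_cons_cons_nil_of_len (F := E) (by rw [len_congr (hlev 0)]; rfl)
  have hsub : ∀ (j : ℕ) (M : Multiset ℕ), M ≤ lev j (cons s (cons c nil)) →
      M.card ≤ (lev j (cons s' nil)).length → M.sum ≤ (lev j (cons s' nil)).sum := by
    intro j M hM hcard
    have := sum_le_sum_getD (hE j) (M := M)
      (fun m => by rw [hlev]; exact excess_le_of_le hM m) hcard
    rwa [lev_cons j s' (cons c' nil), sum_range_getD_append] at this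
  have hle : ∀ j, (lev j (cons s nil) : Multiset ℕ) ≤ lev j (cons s (cons c nil)) := fun j => by
    rw [lev_cons j s (cons c nil), ← Multiset.coe_add]; exact Multiset.le_add_right _ _
  have hlen : ∀ j, (lev j (cons s nil)).length ≤ (lev j (cons s' nil)).length := by
    intro j
    induction j with
    | zero => simp [lev, counts]
    | succ j ih =>
      rw [length_lev_succ, length_lev_succ]
      exact hsub j _ (hle j) ih
  have hwalks : ∀ k, coeff k (treeWalks (cons c s)) ≤ coeff k (treeWalks (cons c' s')) := by
    intro k
    rw [treeWalks_cons, treeWalks_cons, map_add, map_add]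
    exact add_le_add (coeff_walks_le hE (by simp [len]) (fun j m => by rw [hlev]) k)
      (edgeWalks_le_of_sorted hE (fun j m => by rw [hlev]) k)
  have hdegs : degs (cons c' s') = degs (cons c s) := by
    rw [degs_cons, degs_cons, nodes_congr hlev]
  have hE2 := size_depthSum_congr (F := cons s' (cons c' nil)) (G := cons s (cons c nil))
    fun j => by rw [← Multiset.coe_card, hlev, Multiset.coe_card]
  -- Measured from the edge, vertices on the root's side are one step deeper while those beyond the
  -- edge keep their depth. The edge version of the sum does not change under sorting.
  have hd : ∀ c s : Forest, depthSum (cons c s) + size (cons s nil) =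
      depthSum (cons s (cons c nil)) := by
    intro c s
    simp only [depthSum, size, acc]
    omega
  set N := max (size (cons s nil)) (size (cons s' nil)) with hN
  have hs := size_eq_sum_length (F := cons s nil) (le_max_left _ (size (cons s' nil)))
  have hs' := size_eq_sum_length (F := cons s' nil) (le_max_right (size (cons s nil)) _)
  rw [← hN] at hs hs'
  have hsize : size (cons s nil) ≤ size (cons s' nil) := by
    rw [hs, hs']
    exact sum_le_sum fun j _ => hlen j
  rcases hsize.lt_or_eq with hlt | heq
  · right
    refine ⟨cons c' s', hdegs, ?_, hwalks⟩
    have h1 := hd c s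
    have h2 := hd c' s'
    omega
  · left
    have hall : ∀ j, (lev j (cons s nil)).length = (lev j (cons s' nil)).length := by
      intro j
      rcases lt_or_ge j N with hj | hj
      · rw [hs, hs'] at heq
        exact (sum_eq_sum_iff_of_le fun j _ => hlen j).1 heq j (mem_range.2 hj)
      · rw [lev_eq_nil_of_size_le ((le_max_left _ _).trans hj),
          lev_eq_nil_of_size_le ((le_max_right _ _).trans hj)]
    refine ordered_of_separated h (fun j hj => ?_) fun j x hx y hy => ?_
    · have h1 := hall j
      rw [hj] at h1
      have h2 : lev j (cons s' nil) = [] := List.length_eq_zero_iff.1 h1.symm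
      have h3 := hlev j
      rw [lev_cons j s' _, h2, lev_first_eq_nil hE h2, lev_cons j s _, hj] at h3
      simpa using h3.symm
    -- Exchanging `x` for the larger `y` would give a submultiset of the right size with too large a
    -- sum: the largest possible one is the size of the next level of `s'`, which equals that of
    -- `s`.
    · by_contra! hxy
      obtain ⟨M, hM⟩ := Multiset.exists_cons_of_mem (Multiset.mem_coe.2 hx)
      have h1 : y ::ₘ M ≤ lev j (cons s (cons c nil)) := by
        rw [lev_cons j s _, ← Multiset.coe_add, hM, ← Multiset.singleton_add, add_comm]
        exact add_le_add (Multiset.le_cons_self _ _)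
          (Multiset.singleton_le.2 (Multiset.mem_coe.2 hy))
      have h2 := hsub j _ h1 (by
        rw [← hall j, ← Multiset.coe_card, hM]; simp)
      rw [← length_lev_succ, ← hall (j + 1), length_lev_succ, ← Multiset.sum_coe, hM] at h2
      simp at h2
      omega

/-- Every tree can be rearranged into one with ordered degrees without losing closed walks. -/
theorem exists_ordered (F : Forest) : ∃ G, Ordered G ∧ degs G = degs F ∧
    ∀ k, coeff k (treeWalks F) ≤ coeff k (treeWalks G) := by
  induction hn : depthSum F using Nat.strong_induction_on generalizing F with
  | _ n ih =>
  obtain ⟨G, hG, hlev, hlen, hw⟩ := exists_sorted_tree F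
  have hd : depthSum G = depthSum F := (size_depthSum_congr fun j => by
    rw [← Multiset.coe_card, hlev, Multiset.coe_card]).2
  cases G with
  | nil =>
    refine ⟨nil, ⟨hG, fun j x _ y hy => ?_⟩, degs_congr hlev, hw⟩
    simp [dlev, lev_nil] at hy
  | cons c s =>
    rcases exists_improvement hG with ho | ⟨F', h1, h2, h3⟩
    · exact ⟨_, ho, degs_congr hlev, hw⟩
    · obtain ⟨K, hK, hKd, hKw⟩ := ih _ (by omega) F' rfl
      exact ⟨K, hK, by rw [hKd, h1, degs_congr hlev], fun k => ((hw k).trans (h3 k)).trans (hKw k)⟩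

end Forest

end GreedyWalks

/-! ### Breadth-first order and degree transfers. -/

namespace GreedyWalks

open Finset PowerSeries

namespace Forest

/-- The degrees of the vertices of a tree at `n` consecutive distances from the root. -/
def levelOrder (F : Forest) : ℕ → ℕ → List ℕ
  | _, 0 => []
  | j, n + 1 => dlev j F ++ levelOrder F (j + 1) n

theorem dlev_succ_eq_nil {F : Forest} {j : ℕ} (h : dlev j F = []) : dlev (j + 1) F = [] := by
  cases j with
  | zero => simp [dlev] at h
  | succ j =>
    simp only [dlev, List.map_eq_nil_iff] at h ⊢
    rw [← List.length_eq_zero_iff, length_lev_succ, h, List.sum_nil]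

theorem levelOrder_eq_nil {F : Forest} {j : ℕ} (h : dlev j F = []) (n : ℕ) :
    levelOrder F j n = [] := by
  induction n generalizing j with
  | zero => rfl
  | succ n ih => rw [levelOrder, h, ih (dlev_succ_eq_nil h)]; rfl

theorem coe_levelOrder (F : Forest) (j n : ℕ) :
    (levelOrder F j n : Multiset ℕ) = ∑ i ∈ range n, (dlev (j + i) F : Multiset ℕ) := by
  induction n generalizing j with
  | zero => rfl
  | succ n ih =>
    rw [levelOrder, ← Multiset.coe_add, ih, sum_range_succ', add_comm]
    simp only [add_zero, add_assoc, add_comm 1]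

theorem coe_levelOrder_zero {F : Forest} {N : ℕ} (h : size F ≤ N) :
    (levelOrder F 0 (N + 1) : Multiset ℕ) = degs F := by
  rw [coe_levelOrder, sum_range_succ', degs, nodes_eq_sum_lev h]
  have : ∀ s : Finset ℕ, (∑ j ∈ s, (lev j F : Multiset ℕ)).map (· + 1) =
      ∑ j ∈ s, ((lev j F).map (· + 1) : Multiset ℕ) := by
    intro s
    exact map_sum (Multiset.mapAddMonoidHom (· + 1)) (fun j => (lev j F : Multiset ℕ)) s
  rw [this, ← Multiset.singleton_add, add_comm]
  simp [dlev]

theorem Ordered.le_of_mem {F : Forest} (h : Ordered F) {j : ℕ} (i : ℕ) :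
    ∀ x ∈ dlev j F, ∀ y ∈ dlev (j + 1 + i) F, y ≤ x := by
  induction i with
  | zero => exact h.le j
  | succ i ih =>
    intro x hx y hy
    have hne : dlev (j + 1 + i) F ≠ [] := fun h0 => by
      rw [← add_assoc, dlev_succ_eq_nil h0] at hy
      simp at hy
    obtain ⟨z, hz⟩ := List.exists_mem_of_ne_nil _ hne
    exact (h.le _ z hz y hy).trans (ih x hx z hz)

theorem Ordered.pairwise_dlev {F : Forest} (h : Ordered F) (j : ℕ) :
    (dlev j F).Pairwise (· ≥ ·) := by
  cases j with
  | zero => simp [dlev]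
  | succ j =>
    have := h.sorted (j + 1)
    rw [lev_succ_single] at this
    rw [dlev, List.pairwise_map]
    exact this.imp fun h => Nat.succ_le_succ h

theorem Ordered.pairwise_levelOrder {F : Forest} (h : Ordered F) (j n : ℕ) :
    (levelOrder F j n).Pairwise (· ≥ ·) := by
  induction n generalizing j with
  | zero => exact List.Pairwise.nil
  | succ n ih =>
    rw [levelOrder, List.pairwise_append]
    refine ⟨h.pairwise_dlev j, ih _, fun x hx y hy => ?_⟩
    rw [← Multiset.mem_coe, coe_levelOrder, Multiset.mem_sum] at hy
    obtain ⟨i, _, hi⟩ := hy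
    exact h.le_of_mem i x hx y (Multiset.mem_coe.1 hi)

/-- The entries of one level determine the length of the next, so the concatenated list can be cut
back into levels. -/
theorem eq_of_levelOrder_eq {F G : Forest} {j n : ℕ} (h : levelOrder F j n = levelOrder G j n)
    (hj : (dlev j F).length = (dlev j G).length) : ∀ i < n, dlev (j + i) F = dlev (j + i) G := by
  induction n generalizing j with
  | zero => simp
  | succ n ih =>
    obtain ⟨h1, h2⟩ := List.append_inj h hj
    have h3 : (dlev (j + 1) F).length = (dlev (j + 1) G).length := by
      cases j with
      | zero => simpa [dlev, lev, length_counts] using h1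
      | succ j =>
        have h4 : lev j F = lev j G := List.map_injective_iff.2 (add_left_injective 1) h1
        simp only [dlev, List.length_map, length_lev_succ, h4]
    intro i hi
    rcases i with _ | i
    · exact h1
    · have := ih h2 h3 i (by omega)
      rwa [add_assoc, add_comm 1] at this

theorem Ordered.dlev_eq {F G : Forest} (hF : Ordered F) (hG : Ordered G) (h : degs F = degs G)
    (j : ℕ) : dlev j F = dlev j G := by
  set N := max (max (size F) (size G)) j
  have h1 : (levelOrder F 0 (N + 1)).Perm (levelOrder G 0 (N + 1)) := by
    rw [← Multiset.coe_eq_coe, coe_levelOrder_zero ((le_max_left _ _).trans (le_max_left _ _)), h,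
      coe_levelOrder_zero ((le_max_right _ _).trans (le_max_left _ _))]
  have h2 := h1.eq_of_pairwise (fun a b _ _ h1 h2 => le_antisymm h2 h1)
    (hF.pairwise_levelOrder _ _) (hG.pairwise_levelOrder _ _)
  have := eq_of_levelOrder_eq h2 rfl j (Nat.lt_succ_of_le (le_max_right _ _))
  simpa using this

theorem Ordered.treeWalks_le {F G : Forest} (hF : Ordered F) (hG : Ordered G)
    (h : degs F = degs G) (k : ℕ) : coeff k (treeWalks F) ≤ coeff k (treeWalks G) := by
  refine coeff_walks_le (F' := cons F nil) hG.sorted le_rfl (fun j m => ?_) k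
  have : lev j (cons F nil) = lev j (cons G nil) := by
    cases j with
    | zero => simpa [lev, counts, dlev] using hF.dlev_eq hG h 0
    | succ j =>
      rw [lev_succ_single, lev_succ_single]
      exact List.map_injective_iff.2 (add_left_injective 1) (hF.dlev_eq hG h (j + 1))
  rw [this]

theorem levelOrder_consecutive {F : Forest} {j n : ℕ} {p q : List ℕ} {a b : ℕ}
    (h : levelOrder F j n = p ++ a :: b :: q) :
    (∃ i p q, dlev i F = p ++ a :: b :: q) ∨
      ∃ i p q, dlev i F = p ++ [a] ∧ dlev (i + 1) F = b :: q := by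
  induction n generalizing j p with
  | zero => simp [levelOrder] at h
  | succ n ih =>
    rw [levelOrder, List.append_eq_append_iff] at h
    rcases h with ⟨r, rfl, h⟩ | ⟨r, h1, h2⟩
    · exact ih h
    · rcases r with _ | ⟨x, _ | ⟨y, r⟩⟩
      · exact ih (p := []) (by simpa using h2.symm)
      · simp only [List.cons_append, List.nil_append, List.cons.injEq] at h2
        obtain ⟨rfl, h2⟩ := h2
        cases n with
        | zero => simp [levelOrder] at h2
        | succ n =>
          rcases hd : dlev (j + 1) F with _ | ⟨z, t⟩
          · rw [levelOrder_eq_nil hd] at h2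
            simp at h2
          · rw [levelOrder, hd] at h2
            simp only [List.cons_append, List.cons.injEq] at h2
            exact Or.inr ⟨j, p, t, h1, by rw [hd, h2.1]⟩
      · simp only [List.cons_append, List.cons.injEq] at h2
        obtain ⟨rfl, rfl, h2⟩ := h2
        exact Or.inl ⟨j, p, r, h1⟩

theorem nodes_transfer {F G : Forest} {j a b : ℕ}
    (h : ∀ i ≠ j, (lev i G : Multiset ℕ) = lev i F)
    (hj : (lev j G : Multiset ℕ) + {a, b} = lev j F + {a + 1, b - 1}) :
    nodes G + {a, b} = nodes F + {a + 1, b - 1} := by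
  set N := max (max (size F) (size G)) (j + 1)
  have hjN : j ∈ range N := mem_range.2 (Nat.lt_of_succ_le (le_max_right _ _))
  rw [nodes_eq_sum_lev (N := N) ((le_max_left (size F) _).trans (le_max_left _ _)),
    nodes_eq_sum_lev (N := N) ((le_max_right _ (size G)).trans (le_max_left _ _)),
    ← add_sum_erase _ _ hjN, ← add_sum_erase _ _ hjN,
    sum_congr rfl fun i hi => h i (ne_of_mem_erase hi), add_right_comm, hj, add_right_comm]

theorem coeff_starWalks (F : Forest) {k : ℕ} (hk : 1 ≤ k) :
    coeff (2 * k - 1) (starWalks F) = ((nodes F).map fun c : ℕ => 2 * (c : ℚ) ^ k).sum := by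
  have h1 := map_acc (fun c => nodeSeries (C (len c : ℚ)))
    (coeff (R := ℚ) (2 * k - 1)).toAddMonoidHom F
  have h2 : ∀ F : Forest, ((nodes F).map fun c : ℕ => 2 * (c : ℚ) ^ k).sum =
      acc (fun c => 2 * (len c : ℚ) ^ k) F := by
    intro F
    induction F with
    | nil => simp [nodes, acc]
    | cons c s hc hs =>
      simp only [nodes] at hc hs
      simp [nodes, acc, hc, hs, add_assoc]
  rw [h2]
  refine h1.trans (acc_congr (fun c => ?_) F)
  exact coeff_nodeSeries_C _ hk

theorem pow_transfer {a b k : ℕ} (hb : 1 ≤ b) (hab : b ≤ a) (hk : 2 ≤ k) :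
    2 * (a : ℚ) ^ k + 2 * (b : ℚ) ^ k < 2 * ((a + 1 : ℕ) : ℚ) ^ k + 2 * ((b - 1 : ℕ) : ℚ) ^ k := by
  obtain ⟨y, rfl⟩ := Nat.exists_eq_add_of_le' hb
  obtain ⟨k, rfl⟩ := Nat.exists_eq_add_of_le' (show 1 ≤ k by omega)
  rw [Nat.add_sub_cancel]
  push_cast
  have hya : (y : ℚ) + 1 ≤ a := by exact_mod_cast hab
  have hy : (0 : ℚ) ≤ y := by positivity
  have hle : ∀ k, (a : ℚ) ^ k + (y + 1) ^ k ≤ (a + 1) ^ k + (y : ℚ) ^ k := by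
    intro k
    induction k with
    | zero => simp
    | succ k ih =>
      have h1 : (y : ℚ) ^ k ≤ a ^ k := pow_le_pow_left₀ hy (by linarith) k
      have h2 : (a : ℚ) ^ k ≤ (a + 1) ^ k := pow_le_pow_left₀ (by linarith) (by linarith) k
      rw [pow_succ, pow_succ, pow_succ, pow_succ]
      nlinarith
  have h1 : (y : ℚ) ^ k < a ^ k := pow_lt_pow_left₀ (by linarith) hy (by omega)
  have h2 : (a : ℚ) ^ k ≤ (a + 1) ^ k := pow_le_pow_left₀ (by linarith) (by linarith) k
  have h3 := hle k
  rw [pow_succ, pow_succ, pow_succ, pow_succ]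
  nlinarith

theorem excess_le_of_transfer {M N : Multiset ℕ} {a b : ℕ} (hab : b ≤ a)
    (h : N + {a, b} = M + {a + 1, b - 1}) (m : ℕ) : excess M m ≤ excess N m := by
  have := congrArg (excess · m) h
  simp only [excess_add, Multiset.insert_eq_cons, excess_cons,
    ← Multiset.cons_zero] at this
  have h0 : excess 0 m = 0 := rfl
  omega

/-- The transfer is a majorization increase on level `j`. The remainder `walks - starWalks` does not
decrease, and `starWalks` increases strictly by convexity of powers. -/
theorem walks_transfer {F G : Forest} {j a b : ℕ} (hG : Sorted G) (hlen : len G = len F)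
    (hb : 1 ≤ b) (hab : b ≤ a)
    (h : ∀ i ≠ j, (lev i G : Multiset ℕ) = lev i F)
    (hj : (lev j G : Multiset ℕ) + {a, b} = lev j F + {a + 1, b - 1}) :
    (∀ i m, excess (lev i F) m ≤ excess (lev i G) m) ∧
      (∀ k, coeff k (walks F) ≤ coeff k (walks G)) ∧
      ∀ k, 2 ≤ k → coeff (2 * k - 1) (walks F) < coeff (2 * k - 1) (walks G) := by
  have hex : ∀ i m, excess (lev i F) m ≤ excess (lev i G) m := by
    intro i m
    by_cases hi : i = j
    · subst hi
      exact excess_le_of_transfer hab hj m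
    · rw [h i hi]
  refine ⟨hex, coeff_walks_le hG hlen.ge hex, fun k hk => ?_⟩
  have h1 := (walks_le_of_sorted hG hlen.ge hex).2.1 (2 * k - 1)
  have h2 := congrArg (fun M => (Multiset.map (fun c : ℕ => 2 * (c : ℚ) ^ k) M).sum)
    (nodes_transfer h hj)
  simp only [Multiset.map_add, Multiset.sum_add, Multiset.insert_eq_cons, Multiset.map_cons,
    Multiset.map_singleton, Multiset.sum_cons, Multiset.sum_singleton,
    ← coeff_starWalks _ (show 1 ≤ k by omega)] at h2
  have h3 := pow_transfer hb hab hk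
  rw [map_sub, map_sub] at h1
  linarith

theorem Ordered.lev_eq_nil {c s : Forest} (h : Ordered (cons c s)) {j : ℕ}
    (hj : lev j (cons s nil) = []) : lev j (cons c nil) = [] := by
  induction j with
  | zero => simp [lev, counts] at hj
  | succ j ih =>
    have h1 := length_lev_succ j (cons s nil)
    rw [hj] at h1
    rw [← List.length_eq_zero_iff, length_lev_succ]
    by_cases hn : lev j (cons s nil) = []
    · simp [ih hn]
    · obtain ⟨x, hx⟩ := List.exists_mem_of_ne_nil _ hn
      have hx0 : x = 0 := List.sum_eq_zero_iff.1 h1.symm x hx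
      rw [List.sum_eq_zero_iff]
      intro y hy
      have hy' : y + 1 ∈ dlev (j + 1) (cons c s) := by
        rw [dlev, lev_cons]
        exact List.mem_map_of_mem (List.mem_append_left _ hy)
      have hx' : x + 1 ∈ dlev j (cons c s) := by
        cases j with
        | zero => simpa [dlev, lev, counts, len] using hx
        | succ j =>
          rw [lev_succ_single] at hx
          rw [dlev, lev_cons]
          exact List.mem_map_of_mem (List.mem_append_right _ hx)
      have := h.le j _ hx' _ hy'
      omega

/-- Increasing the degree of one vertex at the expense of the next one. -/
theorem Ordered.exists_transfer {F : Forest} (hF : Ordered F) {n a b : ℕ} {p q : List ℕ}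
    (h : levelOrder F 0 n = p ++ a :: b :: q) (hb : 2 ≤ b) :
    ∃ G, degs G + {a, b} = degs F + {a + 1, b - 1} ∧
      (∀ k, coeff k (treeWalks F) ≤ coeff k (treeWalks G)) ∧
      ∀ k, 2 ≤ k → coeff (2 * k - 1) (treeWalks F) < coeff (2 * k - 1) (treeWalks G) := by
  have hab : b ≤ a := by
    have := hF.pairwise_levelOrder 0 n
    rw [h, List.pairwise_append, List.pairwise_cons] at this
    exact this.2.1.1 b (by simp)
  obtain ⟨a, rfl⟩ := Nat.exists_eq_add_of_le' (show 1 ≤ a by omega)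
  obtain ⟨b, rfl⟩ := Nat.exists_eq_add_of_le' (show 1 ≤ b by omega)
  -- Two vertices on the same root level are handled with levels from the root. If `a` ends one
  -- level and `b` begins the next, they share a level around the first edge, on opposite sides of
  -- it.
  rcases levelOrder_consecutive h with ⟨i, p, q, hi⟩ | ⟨i, p, q, hi, hi'⟩
  · cases i with
    | zero =>
      have := congrArg List.length hi
      simp [dlev] at this
      omega
    | succ j =>
      have hj : {a, b} ≤ (lev (j + 1) (cons F nil) : Multiset ℕ) := by
        rw [lev_succ_single]
        have h1 : ((lev j F : Multiset ℕ)).map (· + 1) = ({a, b} : Multiset ℕ).map (· + 1) +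
            ((p ++ q : List ℕ) : Multiset ℕ) := by
          rw [Multiset.map_coe]
          have : (lev j F).map (· + 1) = p ++ (a + 1) :: (b + 1) :: q := hi
          rw [this, ← Multiset.coe_add, ← Multiset.coe_add, ← Multiset.cons_coe,
            ← Multiset.cons_coe]
          simp only [Multiset.insert_eq_cons, Multiset.map_singleton, Multiset.map_add,
            ← Multiset.singleton_add]
          abel
        rw [← Multiset.map_le_map_iff (f := (· + 1)) (add_left_injective 1), h1]
        exact Multiset.le_add_right _ _
      obtain ⟨G', hG, hlen, hlev, hlj⟩ := exists_sorted_transfer hj (by omega)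
      obtain ⟨G, rfl⟩ := eq_cons_nil_of_len (F := G') (by rw [hlen]; rfl)
      obtain ⟨-, h1, h2⟩ := walks_transfer hG hlen (by omega) (by omega) hlev hlj
      refine ⟨G, ?_, h1, h2⟩
      have h0 : len G = len F := by
        have := hlev 0 (by omega)
        simpa [lev, counts] using this
      have h3 := congrArg (Multiset.map (· + 1)) (nodes_transfer hlev hlj)
      have h4 : ∀ K : Forest, nodes (cons K nil) = len K ::ₘ nodes K := fun K => by
        simp [nodes, acc]
      simp only [h4, h0, Multiset.map_add, Multiset.map_cons, Multiset.cons_add,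
        Multiset.cons_inj_right, Multiset.insert_eq_cons, Multiset.map_singleton] at h3
      rw [degs, degs, h0, Multiset.cons_add, Multiset.cons_add, Multiset.cons_inj_right]
      simpa [show b - 1 + 1 = b by omega] using h3
  · cases F with
    | nil => simp [dlev, lev_nil] at hi'
    | cons c s =>
      have hF' : Sorted (cons c s) := fun j => by
        have := hF.sorted (j + 1)
        rwa [lev_succ_single] at this
      have hbmem : b ∈ lev i (cons c nil) := by
        rw [dlev, lev_cons, List.map_append] at hi'
        rcases hA : lev i (cons c nil) with _ | ⟨z, t⟩
        · rw [hA, lev_first_eq_nil hF' hA] at hi'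
          simp at hi'
        · rw [hA] at hi'
          simp only [List.map_cons, List.cons_append, List.cons.injEq] at hi'
          simp; omega
      have hamem : a ∈ lev i (cons s nil) := by
        -- On level `0` the vertex is the root, which loses the edge to its first child and so has
        -- `len s` children in its half.
        cases i with
        | zero =>
          have := congrArg List.getLast? hi
          simp [dlev, len] at this
          simp [lev, counts, this]
        | succ j =>
          have hne : lev (j + 1) (cons s nil) ≠ [] := fun h0 => by
            simp [hF.lev_eq_nil h0] at hbmem
          rw [lev_succ_single] at hne ⊢
          have := congrArg List.getLast? hi
          rw [dlev, lev_cons] at this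
          simp only [List.map_append, List.getLast?_append, List.getLast?_singleton,
            List.getLast?_map, List.getLast?_eq_some_getLast hne, Option.map_some,
            Option.some_or, Option.some.injEq] at this
          have h1 : (lev j s).getLast hne = a := by omega
          rw [← h1]
          exact List.getLast_mem hne
      have hj : {a, b} ≤ (lev i (cons s (cons c nil)) : Multiset ℕ) := by
        rw [lev_cons i s (cons c nil), ← Multiset.coe_add, Multiset.insert_eq_cons,
          ← Multiset.singleton_add]
        exact add_le_add (Multiset.singleton_le.2 (Multiset.mem_coe.2 hamem))
          (Multiset.singleton_le.2 (Multiset.mem_coe.2 hbmem))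
      obtain ⟨E, hE, hlen, hlev, hlj⟩ := exists_sorted_transfer hj (by omega)
      obtain ⟨s', c', rfl⟩ := eq_cons_cons_nil_of_len (F := E) (by rw [hlen]; rfl)
      obtain ⟨h0, h1, h2⟩ := walks_transfer hE hlen (by omega) (by omega) hlev hlj
      have h3 := edgeWalks_le_of_sorted hE h0
      refine ⟨cons c' s', ?_, fun k => ?_, fun k hk => ?_⟩
      · have h4 := congrArg (Multiset.map (· + 1)) (nodes_transfer hlev hlj)
        rw [Multiset.map_add, Multiset.map_add, ← degs_cons, ← degs_cons] at h4
        simpa [show b - 1 + 1 = b by omega] using h4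
      · rw [treeWalks_cons, treeWalks_cons, map_add, map_add]
        exact add_le_add (h1 k) (h3 k)
      · rw [treeWalks_cons, treeWalks_cons, map_add, map_add]
        exact add_lt_add_of_lt_of_le (h2 k hk) (h3 _)

/-- At the first difference the term `a` of `l` lies below that of `d`; let `b` be the next term of
`l`. For `b ≤ m ≤ a` the later terms of `l` have no excess, so the gap at the first difference makes
the inequality strict. -/
theorem exists_consecutive {l d : List ℕ} (hl : l.Pairwise (· ≥ ·)) (hd : d.Pairwise (· ≥ ·))
    (hlen : l.length = d.length) (hsum : l.sum = d.sum) (hpos : ∀ y ∈ d, 1 ≤ y)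
    (hex : ∀ m, excess l m ≤ excess d m) (hne : l ≠ d) :
    ∃ p a b q, l = p ++ a :: b :: q ∧ 2 ≤ b ∧ ∀ m, b ≤ m → m ≤ a → excess l m < excess d m := by
  induction l generalizing d with
  | nil => exact absurd (List.length_eq_zero_iff.1 hlen.symm).symm hne
  | cons x l ih =>
    rcases d with _ | ⟨y, d⟩
    · simp at hlen
    rw [List.pairwise_cons] at hl hd
    simp only [List.length_cons, List.sum_cons, Nat.add_right_cancel_iff] at hlen hsum
    simp only [← Multiset.cons_coe, excess_cons] at hex ⊢
    rcases lt_trichotomy x y with hxy | rfl | hxy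
    · rcases l with _ | ⟨b, q⟩
      · rw [List.length_eq_zero_iff.1 hlen.symm] at hsum
        simp at hsum
        omega
      · refine ⟨[], x, b, q, rfl, ?_, fun m hbm hmx => ?_⟩
        -- If `b ≤ 1`, the rest of `l` would sum to at most its length and the rest of `d` to at
        -- least the same length, contradicting equal totals with `x < y`.
        · by_contra! hb
          rw [List.pairwise_cons] at hl
          have h1 : (b :: q).sum ≤ (b :: q).length * 1 := by
            refine List.sum_le_card_nsmul _ 1 fun z hz => ?_
            rcases List.mem_cons.1 hz with rfl | hz
            · omega
            · have := hl.2.1 z hz; omega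
          have h2 : d.length * 1 ≤ d.sum :=
            List.card_nsmul_le_sum _ 1 fun z hz => hpos z (List.mem_cons_of_mem _ hz)
          omega
        · have : excess (b :: q : List ℕ) m = 0 := excess_eq_zero fun z hz => by
            rw [List.pairwise_cons] at hl
            rcases List.mem_cons.1 (Multiset.mem_coe.1 hz) with rfl | hz
            · exact hbm
            · exact (hl.2.1 z hz).trans hbm
          omega
    · obtain ⟨p, a, b, q, rfl, h1, h2⟩ := ih hl.2 hd.2 hlen (by omega)
        (fun z hz => hpos z (List.mem_cons_of_mem _ hz))
        (fun m => Nat.le_of_add_le_add_left (hex m)) (fun h => hne (by rw [h]))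
      exact ⟨x :: p, a, b, q, rfl, h1, fun m h3 h4 => Nat.add_lt_add_left (h2 m h3 h4) _⟩
    · have h1 := hex y
      have h2 : excess d y = 0 := excess_eq_zero fun z hz => hd.1 z (Multiset.mem_coe.1 hz)
      omega

/-- Trees with ordered degrees have the most closed walks among all trees with majorized
degrees. -/
theorem Ordered.treeWalks_max {T : Forest} (hT : Ordered T) (F : Forest)
    (hcard : (degs F).card = (degs T).card) (hsum : (degs F).sum = (degs T).sum)
    (hpos : ∀ y ∈ degs T, 1 ≤ y) (hex : ∀ m, excess (degs F) m ≤ excess (degs T) m) :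
    (∀ k, coeff k (treeWalks F) ≤ coeff k (treeWalks T)) ∧
      (degs F ≠ degs T → ∀ k, 2 ≤ k →
        coeff (2 * k - 1) (treeWalks F) < coeff (2 * k - 1) (treeWalks T)) := by
  obtain ⟨s, hs⟩ : ∃ s, s = (degs T).sum := ⟨_, rfl⟩
  -- The gap depends only on the degrees, so `F` may be replaced by an ordered tree first.
  -- Thresholds up to `s` suffice because `a ≤ s`.
  induction hn : ∑ m ∈ range (s + 1), (excess (degs T) m - excess (degs F) m)
    using Nat.strong_induction_on generalizing F with
  | _ n ih =>
  obtain ⟨G, hG, hdeg, hw⟩ := exists_ordered F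
  by_cases heq : degs F = degs T
  · exact ⟨fun k => (hw k).trans (hG.treeWalks_le hT (hdeg.trans heq) k), fun h => absurd heq h⟩
  have hl := coe_levelOrder_zero (F := G) le_rfl
  have hd := coe_levelOrder_zero (F := T) le_rfl
  rw [hdeg] at hl
  obtain ⟨p, a, b, q, hpq, hb, hstrict⟩ := exists_consecutive
    (hG.pairwise_levelOrder 0 (size G + 1)) (hT.pairwise_levelOrder 0 (size T + 1))
    (by rw [← Multiset.coe_card, hl, hcard, ← hd, Multiset.coe_card])
    (by rw [← Multiset.sum_coe, hl, hsum, ← hd, Multiset.sum_coe])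
    (by simpa only [← Multiset.mem_coe, hd] using hpos)
    (by simpa only [hl, hd] using hex)
    (fun h => heq (by rw [← hl, h, hd]))
  simp only [hl, hd] at hstrict
  obtain ⟨K, hK, hK1, hK2⟩ := hG.exists_transfer hpq hb
  rw [hdeg] at hK
  have hab : b ≤ a := by
    have := hG.pairwise_levelOrder 0 (size G + 1)
    rw [hpq, List.pairwise_append, List.pairwise_cons] at this
    exact this.2.1.1 b (by simp)
  have has : a ≤ s := by
    rw [hs, ← hsum, ← hl, hpq]
    exact Multiset.single_le_sum (fun _ _ => Nat.zero_le _) a (by simp)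
  have hKex : ∀ m, excess (degs K) m + ((a - m) + (b - m)) =
      excess (degs F) m + ((a + 1 - m) + (b - 1 - m)) := by
    intro m
    have := congrArg (excess · m) hK
    simp [← Multiset.cons_zero] at this
    omega
  -- The transfer raises the excess by one exactly for `b ≤ m ≤ a`, where there was room.
  have h0 : ∀ m, excess (degs K) m ≤ excess (degs T) m := by
    intro m
    have h1 := hKex m
    have h2 := hex m
    by_cases hm : b ≤ m ∧ m ≤ a
    · have := hstrict m hm.1 hm.2
      omega
    · omega
  have hKF := excess_le_of_transfer hab hK
  obtain ⟨h1, -⟩ := ih _ (by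
    rw [← hn]
    refine sum_lt_sum (fun m _ => ?_) ⟨a, mem_range.2 (by omega), ?_⟩
    · have := hKF m
      omega
    · have h1 := hKex a
      have h2 := hstrict a hab le_rfl
      omega) K
    (by
      have := congrArg Multiset.card hK
      simp at this
      omega)
    (by
      have := congrArg Multiset.sum hK
      simp at this
      omega) h0 rfl
  exact ⟨fun k => ((hw k).trans (hK1 k)).trans (h1 k),
    fun _ k hk => ((hw _).trans_lt (hK2 k hk)).trans_le (h1 _)⟩

end Forest

end GreedyWalks

/-! ### The greedy construction as a plane tree. -/

namespace GreedyWalks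

open Finset PowerSeries

/-- In the list of vertices in which each vertex `i` takes the next `c i` unused vertices as its
children, `firstChild c i` is the position of the first child of `i`. -/
def firstChild (c : ℕ → ℕ) (i : ℕ) : ℕ := 1 + ∑ m ∈ range i, c m

theorem firstChild_succ (c : ℕ → ℕ) (i : ℕ) : firstChild c (i + 1) = firstChild c i + c i := by
  rw [firstChild, sum_range_succ, firstChild, add_assoc]

theorem firstChild_zero (c : ℕ → ℕ) : firstChild c 0 = 1 := by simp [firstChild]

theorem firstChild_mono (c : ℕ → ℕ) : Monotone (firstChild c) := fun _ _ h =>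
  Nat.add_le_add_left (sum_le_sum_of_subset (range_subset_range.2 h)) _

/-- The numbers of children `c 0, …, c (n - 1)` define a tree. -/
structure IsTreeCount (n : ℕ) (c : ℕ → ℕ) : Prop where
  lt : ∀ i < n, i < firstChild c i
  total : firstChild c n = n

theorem IsTreeCount.pos {n : ℕ} {c : ℕ → ℕ} (h : IsTreeCount n c) : 1 ≤ n := by
  rw [← h.total, firstChild]; omega

namespace Forest

/-- The forest of the trees `t a, …, t (a + m - 1)`. -/
def ofRange (t : ℕ → Forest) : ℕ → ℕ → Forest
  | _, 0 => nil
  | a, m + 1 => cons (t a) (ofRange t (a + 1) m)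

section OfRange

variable {t : ℕ → Forest}

theorem ofRange_congr {t' : ℕ → Forest} {a m : ℕ} (h : ∀ j, a ≤ j → t j = t' j) :
    ofRange t a m = ofRange t' a m := by
  induction m generalizing a with
  | zero => rfl
  | succ m ih => rw [ofRange, ofRange, h a le_rfl, ih fun j hj => h j (by omega)]

theorem len_ofRange (a m : ℕ) : len (ofRange t a m) = m := by
  induction m generalizing a with
  | zero => rfl
  | succ m ih => rw [ofRange, len, ih]

theorem append_ofRange (a m m' : ℕ) :
    append (ofRange t a m) (ofRange t (a + m) m') = ofRange t a (m + m') := by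
  induction m generalizing a with
  | zero => simp [ofRange, append]
  | succ m ih =>
    rw [ofRange, append, show a + (m + 1) = a + 1 + m by omega, ih,
      show m + 1 + m' = m + m' + 1 by omega, ofRange]

theorem counts_ofRange (a m : ℕ) :
    counts (ofRange t a m) = (List.range' a m).map fun i => len (t i) := by
  induction m generalizing a with
  | zero => rfl
  | succ m ih => rw [ofRange, counts, ih, List.range'_succ, List.map_cons]

theorem acc_ofRange {M : Type*} [AddCommMonoid M] (g : Forest → M) (a m : ℕ) :
    acc g (ofRange t a m) = ∑ j ∈ Ico a (a + m), (g (t j) + acc g (t j)) := by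
  induction m generalizing a with
  | zero => simp [ofRange, acc]
  | succ m ih =>
    rw [ofRange, acc, ih, sum_eq_sum_Ico_succ_bot (show a < a + (m + 1) by omega),
      show a + 1 + m = a + (m + 1) by omega]

theorem walkSum_ofRange (a m : ℕ) :
    walkSum (ofRange t a m) = ∑ j ∈ Ico a (a + m), (1 - X ^ 2 * walkSum (t j))⁻¹ := by
  induction m generalizing a with
  | zero => simp [ofRange, walkSum]
  | succ m ih =>
    rw [ofRange, walkSum, ih, sum_eq_sum_Ico_succ_bot (show a < a + (m + 1) by omega),
      show a + 1 + m = a + (m + 1) by omega]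

end OfRange

/-- `t i` is the child forest of the vertex `i`. -/
def IsGreedyFamily (n : ℕ) (c : ℕ → ℕ) (t : ℕ → Forest) : Prop :=
  ∀ i < n, t i = ofRange t (firstChild c i) (c i)

/-- Children carry larger labels than their parent, so the trees are defined from the last vertex
backwards; `N` counts the vertices already treated. -/
theorem exists_isGreedyFamily {n : ℕ} {c : ℕ → ℕ} (hc : IsTreeCount n c) :
    ∃ t, IsGreedyFamily n c t := by
  have : ∀ N ≤ n, ∃ t : ℕ → Forest, ∀ i, n - N ≤ i → i < n →
      t i = ofRange t (firstChild c i) (c i) := by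
    intro N
    induction N with
    | zero => exact fun _ => ⟨fun _ => nil, fun i h1 h2 => by omega⟩
    | succ N ih =>
      intro hN
      obtain ⟨t, ht⟩ := ih (by omega)
      have hcongr : ∀ i, n - (N + 1) ≤ i → i < n →
          ofRange (Function.update t (n - (N + 1))
            (ofRange t (firstChild c (n - (N + 1))) (c (n - (N + 1))))) (firstChild c i) (c i) =
          ofRange t (firstChild c i) (c i) := fun i h1 h2 =>
        ofRange_congr fun j hj => Function.update_of_ne (by have := hc.lt i h2; omega) _ _
      refine ⟨Function.update t (n - (N + 1))
        (ofRange t (firstChild c (n - (N + 1))) (c (n - (N + 1)))), fun i h1 h2 => ?_⟩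
      rw [hcongr i h1 h2]
      rcases h1.eq_or_lt with rfl | h1
      · rw [Function.update_self]
      · rw [Function.update_of_ne (by omega)]
        exact ht i (by omega) h2
  obtain ⟨t, ht⟩ := this n le_rfl
  exact ⟨t, fun i hi => ht i (by omega) hi⟩

namespace IsGreedyFamily

variable {n : ℕ} {c : ℕ → ℕ} {t : ℕ → Forest}

theorem len_eq (ht : IsGreedyFamily n c t) {i : ℕ} (hi : i < n) : len (t i) = c i := by
  rw [ht i hi, len_ofRange]

/-- The child intervals partition the labels `1, …, n - 1`. Summing `A i`, the total over the tree
at `i`, over all vertices therefore reproduces every summand except that of the root, and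
cancellation leaves the claim. -/
theorem acc_eq {M : Type*} [AddCancelCommMonoid M] (g : Forest → M) (hc : IsTreeCount n c)
    (ht : IsGreedyFamily n c t) : acc g (cons (t 0) nil) = ∑ i ∈ range n, g (t i) := by
  set A : ℕ → M := fun i => g (t i) + acc g (t i) with hA
  have h1 : ∀ m ≤ n, ∑ i ∈ range m, A i = ∑ i ∈ range m, g (t i) +
      ∑ j ∈ Ico 1 (firstChild c m), A j := by
    intro m
    induction m with
    | zero => simp [firstChild_zero]
    | succ m ih =>
      intro hm
      have h2 : 1 ≤ firstChild c m := by rw [firstChild]; omega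
      rw [sum_range_succ, ih (by omega), sum_range_succ, firstChild_succ,
        ← sum_Ico_consecutive _ h2 (Nat.le_add_right _ (c m))]
      have h3 : A m = g (t m) + ∑ j ∈ Ico (firstChild c m) (firstChild c m + c m), A j := by
        rw [← acc_ofRange, ← ht m (by omega)]
      rw [h3]
      abel
  have h2 := h1 n le_rfl
  rw [hc.total, range_eq_Ico, sum_eq_sum_Ico_succ_bot hc.pos, zero_add] at h2
  have h3 := add_right_cancel h2
  rw [← range_eq_Ico] at h3
  rw [← h3]
  simp [hA, acc]

theorem iterate_le (hc : IsTreeCount n c) {a : ℕ} (ha : a ≤ n) (j : ℕ) :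
    (firstChild c)^[j] a ≤ n := by
  induction j generalizing a with
  | zero => exact ha
  | succ j ih =>
    refine ih (a := firstChild c a) ?_
    conv_rhs => rw [← hc.total]
    exact firstChild_mono c ha

theorem down_ofRange (ht : IsGreedyFamily n c t) {a m : ℕ} (h : a + m ≤ n) :
    down (ofRange t a m) =
      ofRange t (firstChild c a) (firstChild c (a + m) - firstChild c a) := by
  induction m generalizing a with
  | zero => simp [ofRange, down]
  | succ m ih =>
    have h1 := firstChild_mono c (show a + 1 ≤ a + 1 + m by omega)
    rw [firstChild_succ] at h1
    rw [ofRange, down, ih (by omega), ht a (by omega), firstChild_succ, append_ofRange,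
      show a + 1 + m = a + (m + 1) by omega]
    rw [show a + 1 + m = a + (m + 1) by omega] at h1
    congr 1
    omega

/-- `firstChild` maps the endpoints of an interval of labels to the endpoints of the interval of
their children. -/
theorem lev_ofRange (hc : IsTreeCount n c) (ht : IsGreedyFamily n c t) {a b : ℕ} (hab : a ≤ b)
    (h : b ≤ n) (j : ℕ) :
    lev j (ofRange t a (b - a)) =
      (List.range' ((firstChild c)^[j] a) ((firstChild c)^[j] b - (firstChild c)^[j] a)).map c := by
  induction j generalizing a b with
  | zero =>
    rw [lev, counts_ofRange]
    refine List.map_congr_left fun i hi => ?_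
    rw [List.mem_range'_1] at hi
    exact ht.len_eq (by omega)
  | succ j ih =>
    rw [lev, ht.down_ofRange (by omega), show a + (b - a) = b by omega]
    exact ih (firstChild_mono c hab) (iterate_le hc h 1)

theorem pairwise_map_range' {c : ℕ → ℕ} (hanti : Antitone c) (a m : ℕ) :
    ((List.range' a m).map c).Pairwise (· ≥ ·) := by
  rw [List.pairwise_map]
  exact List.pairwise_le_range'.imp fun h => hanti h

/-- Since `firstChild c 0 = 1`, the levels are consecutive label intervals and antitonicity suffices
below the root. The root needs `hroot`, as its degree has no parent edge to add. -/
theorem ordered (hc : IsTreeCount n c) (ht : IsGreedyFamily n c t) (hanti : Antitone c)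
    (hroot : ∀ i, 1 ≤ i → i < n → c i + 1 ≤ c 0) : Ordered (t 0) := by
  have hlev : ∀ j, lev j (cons (t 0) nil) = (List.range' ((firstChild c)^[j] 0)
      ((firstChild c)^[j] 1 - (firstChild c)^[j] 0)).map c := fun j =>
    ht.lev_ofRange hc zero_le_one hc.pos j
  have hiter : ∀ j, (firstChild c)^[j + 1] 0 = (firstChild c)^[j] 1 := fun j => by
    rw [Function.iterate_succ_apply, firstChild_zero]
  have hlev' : ∀ j, lev j (t 0) = (List.range' ((firstChild c)^[j] 1)
      ((firstChild c)^[j + 1] 1 - (firstChild c)^[j] 1)).map c := fun j => by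
    rw [← lev_succ_single, hlev, hiter]
  have hpos : ∀ j, 1 ≤ (firstChild c)^[j] 1 := fun j => by
    rw [← hiter, Function.iterate_succ_apply', firstChild]; omega
  refine ⟨fun j => by rw [hlev]; exact pairwise_map_range' hanti _ _, fun j x hx y hy => ?_⟩
  rw [dlev, hlev'] at hy
  simp only [List.map_map, List.mem_map, List.mem_range'_1, Function.comp_apply] at hy
  obtain ⟨i', hi', rfl⟩ := hy
  cases j with
  | zero =>
    simp only [dlev, List.mem_singleton] at hx
    rw [hx, ht.len_eq hc.pos]
    have := iterate_le hc hc.pos 1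
    have := hpos 0
    exact hroot i' (by omega) (by simp only [zero_add] at hi'; omega)
  | succ j =>
    rw [dlev, hlev'] at hx
    simp only [List.map_map, List.mem_map, List.mem_range'_1, Function.comp_apply] at hx
    obtain ⟨i, hi, rfl⟩ := hx
    exact Nat.succ_le_succ (hanti (by omega))

theorem degs_eq (hc : IsTreeCount n c) (ht : IsGreedyFamily n c t) :
    degs (t 0) = ((List.range n).map fun i => if i = 0 then c i else c i + 1 : List ℕ) := by
  have h1 : nodes (cons (t 0) nil) = ∑ i ∈ range n, {len (t i)} :=
    ht.acc_eq (fun c => {len c}) hc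
  have h2 : nodes (cons (t 0) nil) = len (t 0) ::ₘ nodes (t 0) := by simp [nodes, acc]
  obtain ⟨m, rfl⟩ := Nat.exists_eq_add_of_le' hc.pos
  rw [h2, sum_range_succ', ← Multiset.singleton_add, add_comm] at h1
  have h3 := add_right_cancel h1
  rw [degs, h3, ht.len_eq hc.pos, List.range_succ_eq_map, List.map_cons, if_pos rfl,
    ← Multiset.cons_coe, List.map_map]
  congr 1
  have h4 : ∀ l ≤ m, (∑ i ∈ range l, ({len (t (i + 1))} : Multiset ℕ)).map (· + 1) =
      ((List.range l).map fun i => c (i + 1) + 1 : List ℕ) := by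
    intro l
    induction l with
    | zero => intro _; rfl
    | succ l ih =>
      intro hl
      rw [sum_range_succ, Multiset.map_add, ih (by omega), ht.len_eq (by omega), List.range_succ,
        List.map_append, ← Multiset.coe_add]
      rfl
  exact h4 m le_rfl

theorem treeWalks_eq (hc : IsTreeCount n c) (ht : IsGreedyFamily n c t) :
    treeWalks (t 0) = ∑ i ∈ range n, nodeSeries (walkSum (t i)) :=
  ht.acc_eq (fun c => nodeSeries (walkSum c)) hc

theorem walkSum_eq (ht : IsGreedyFamily n c t) {i : ℕ} (hi : i < n) :
    walkSum (t i) = ∑ j ∈ Ico (firstChild c i) (firstChild c i + c i),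
      (1 - X ^ 2 * walkSum (t j))⁻¹ := by
  conv_lhs => rw [ht i hi]
  exact walkSum_ofRange _ _

end IsGreedyFamily

end Forest

end GreedyWalks

/-! ### Closed walks as traces, and the factorization of `1 - X A`. -/

namespace GreedyWalks

open Finset PowerSeries Matrix

section Trace

variable {n : ℕ}

/-- Entrywise derivative. -/
noncomputable def dMat (M : Matrix (Fin n) (Fin n) ℚ⟦X⟧) : Matrix (Fin n) (Fin n) ℚ⟦X⟧ :=
  M.map (d⁄dX ℚ)

theorem dMat_mul (M N : Matrix (Fin n) (Fin n) ℚ⟦X⟧) :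
    dMat (M * N) = dMat M * N + M * dMat N := by
  ext1 i j
  simp only [dMat, Matrix.map_apply, Matrix.mul_apply, Matrix.add_apply, map_sum,
    Derivation.leibniz, smul_eq_mul, ← sum_add_distrib]
  exact sum_congr rfl fun k _ => by ring

theorem coeff_trace_mul_inv (A : Matrix (Fin n) (Fin n) ℚ) (N : Matrix (Fin n) (Fin n) ℚ⟦X⟧)
    (h : (1 - (X : ℚ⟦X⟧) • A.map C) * N = 1) (k : ℕ) :
    coeff k (trace (A.map C * N)) = trace (A ^ (k + 1)) := by
  set P : Matrix (Fin n) (Fin n) ℚ⟦X⟧ := Matrix.of fun i j => PowerSeries.mk fun k => (A ^ k) i j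
  have hP : (1 - (X : ℚ⟦X⟧) • A.map C) * P = 1 := by
    ext i j k
    rw [Matrix.sub_mul, Matrix.one_mul, Matrix.smul_mul, Matrix.sub_apply, map_sub,
      Matrix.smul_apply, smul_eq_mul, Matrix.mul_apply]
    cases k with
    | zero =>
      simp only [coeff_zero_X_mul, sub_zero, P, Matrix.of_apply, coeff_mk, pow_zero,
        Matrix.one_apply]
      split_ifs <;> simp
    | succ k =>
      simp only [coeff_succ_X_mul, map_sum, Matrix.map_apply, coeff_C_mul, P, Matrix.of_apply,
        coeff_mk]
      rw [pow_succ', Matrix.mul_apply, sub_self, Matrix.one_apply]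
      split_ifs <;> simp [coeff_one]
  have hNP : N = P := by
    have h1 := mul_eq_one_comm.1 h
    calc N = N * ((1 - (X : ℚ⟦X⟧) • A.map C) * P) := by rw [hP, mul_one]
      _ = P := by rw [← mul_assoc, h1, one_mul]
  rw [hNP, pow_succ']
  simp [Matrix.trace, Matrix.mul_apply, P]

/-- The traces of the powers of the adjacency matrix of a tree given by a relation `R i j` which
says that `j` is a child of `i`. -/
theorem trace_pow_of_parent (R : Fin n → Fin n → Prop) [DecidableRel R]
    (hlt : ∀ i j, R i j → i < j) (huniq : ∀ i i' j, R i j → R i' j → i = i')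
    (u : Fin n → ℚ⟦X⟧) (hu : ∀ i, u i = ∑ j, if R i j then (1 - X ^ 2 * u j)⁻¹ else 0)
    (A : Matrix (Fin n) (Fin n) ℚ)
    (hA : ∀ i j, A i j = (if R i j then 1 else 0) + if R j i then 1 else 0) (k : ℕ) :
    trace (A ^ (k + 1)) = coeff k (∑ i, nodeSeries (u i)) := by
  set Q : Matrix (Fin n) (Fin n) ℚ⟦X⟧ := Matrix.of fun i j => if R i j then 1 else 0 with hQ
  set F : Matrix (Fin n) (Fin n) ℚ⟦X⟧ := Matrix.diagonal fun i => (1 - X ^ 2 * u i)⁻¹ with hF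
  set L : Matrix (Fin n) (Fin n) ℚ⟦X⟧ := Matrix.diagonal fun i => 1 - X ^ 2 * u i with hL
  set U : Matrix (Fin n) (Fin n) ℚ⟦X⟧ := 1 - (X : ℚ⟦X⟧) • (Q * F) with hU
  have hLF : L * F = 1 := by
    rw [hL, hF, Matrix.diagonal_mul_diagonal]
    simp
  have hFL : F * L = 1 := mul_eq_one_comm.1 hLF
  have hQF : ∀ i j, (Q * F) i j = if R i j then (1 - X ^ 2 * u j)⁻¹ else 0 := fun i j => by
    simp [hQ, hF, Matrix.mul_diagonal]
  -- Off the diagonal this vanishes because a vertex has only one parent; on the diagonal it is the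
  -- recursion for `u`.
  have hQFQ : Q * F * Qᵀ = Matrix.diagonal u := by
    ext1 i j
    rw [Matrix.mul_apply]
    simp_rw [hQF]
    simp only [hQ, Matrix.transpose_apply, Matrix.of_apply]
    rcases eq_or_ne i j with rfl | hij
    · rw [Matrix.diagonal_apply_eq, hu]
      exact sum_congr rfl fun l _ => by split_ifs <;> simp
    · rw [Matrix.diagonal_apply_ne _ hij]
      refine sum_eq_zero fun l _ => ?_
      by_cases h1 : R i l
      · by_cases h2 : R j l
        · exact absurd (huniq _ _ _ h1 h2) hij
        · simp [h2]
      · simp [h1]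
  have hM : 1 - (X : ℚ⟦X⟧) • A.map C = U * L * Uᵀ := by
    have hA' : A.map C = Q + Qᵀ := by
      ext1 i j
      simp only [Matrix.map_apply, hA, Matrix.add_apply, Matrix.transpose_apply, hQ,
        Matrix.of_apply]
      split_ifs <;> simp
    have hFT : Fᵀ = F := Matrix.diagonal_transpose _
    have hUT : Uᵀ = 1 - (X : ℚ⟦X⟧) • (F * Qᵀ) := by
      rw [hU, Matrix.transpose_sub, Matrix.transpose_one, Matrix.transpose_smul,
        Matrix.transpose_mul, hFT]
    have hUL : U * L = L - (X : ℚ⟦X⟧) • Q := by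
      rw [hU, Matrix.sub_mul, Matrix.one_mul, Matrix.smul_mul, Matrix.mul_assoc, hFL,
        Matrix.mul_one]
    rw [hUL, hUT, Matrix.sub_mul, Matrix.mul_sub, Matrix.mul_sub, Matrix.mul_one, Matrix.mul_one,
      Matrix.mul_smul, ← Matrix.mul_assoc, hLF, Matrix.one_mul, Matrix.smul_mul, Matrix.mul_smul,
      ← Matrix.mul_assoc, hQFQ, smul_smul, hA', smul_add]
    have : L = 1 - ((X : ℚ⟦X⟧) * X) • Matrix.diagonal u := by
      ext1 i j
      rcases eq_or_ne i j with rfl | hij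
      · simp [hL, sq]
      · simp [hL, hij]
    rw [this]
    abel
  have hUtri : U.BlockTriangular id := by
    intro i j hij
    have h1 : ¬ R i j := fun h => absurd (hlt i j h) (not_lt.2 (le_of_lt hij))
    have h2 : i ≠ j := fun h => by subst h; exact lt_irrefl _ hij
    rw [hU, Matrix.sub_apply, Matrix.smul_apply, hQF, if_neg h1, Matrix.one_apply_ne h2]
    simp
  have hUdiag : ∀ i, U i i = 1 := fun i => by
    have h1 : ¬ R i i := fun h => lt_irrefl _ (hlt i i h)
    rw [hU, Matrix.sub_apply, Matrix.smul_apply, hQF, if_neg h1, Matrix.one_apply_eq]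
    simp
  have hdet : IsUnit U.det := by
    rw [Matrix.det_of_isUpperTriangular hUtri]
    simp [hUdiag]
  have hUV : U * U⁻¹ = 1 := Matrix.mul_nonsing_inv _ hdet
  have hVU : U⁻¹ * U = 1 := Matrix.nonsing_inv_mul _ hdet
  set V := U⁻¹ with hV
  have hVtri : V.BlockTriangular id := by
    have := Matrix.invertibleOfIsUnitDet _ hdet
    exact Matrix.blockTriangular_inv_of_blockTriangular hUtri
  have hUV' : Uᵀ * Vᵀ = 1 := by rw [← Matrix.transpose_mul, hVU, Matrix.transpose_one]
  have hVU' : Vᵀ * Uᵀ = 1 := by rw [← Matrix.transpose_mul, hUV, Matrix.transpose_one]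
  have hMN : (1 - (X : ℚ⟦X⟧) • A.map C) * (Vᵀ * F * V) = 1 := by
    rw [hM]
    calc U * L * Uᵀ * (Vᵀ * F * V) = U * (L * ((Uᵀ * Vᵀ) * F)) * V := by
          simp only [Matrix.mul_assoc]
      _ = 1 := by rw [hUV', Matrix.one_mul, hLF, Matrix.mul_one, hUV]
  rw [← coeff_trace_mul_inv A _ hMN k]
  congr 1
  have hdM : dMat (1 - (X : ℚ⟦X⟧) • A.map C) = -A.map C := by
    ext1 i j
    simp only [dMat, Matrix.map_apply, Matrix.sub_apply, Matrix.smul_apply, smul_eq_mul, map_sub,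
      Derivation.leibniz, Matrix.neg_apply, Matrix.one_apply]
    have h1 : d⁄dX ℚ (if i = j then (1 : ℚ⟦X⟧) else 0) = 0 := by split_ifs <;> simp
    rw [h1]
    simp [derivative_C, derivative_X]
  -- `U` has constant diagonal, so its derivative is strictly upper triangular while `V` is upper
  -- triangular. Only `L` contributes to the logarithmic derivative.
  have htrU : trace (dMat U * V) = 0 := by
    rw [Matrix.trace]
    refine sum_eq_zero fun i _ => ?_
    rw [Matrix.diag_apply, Matrix.mul_apply]
    refine sum_eq_zero fun j _ => ?_
    rcases lt_or_ge i j with hij | hij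
    · rw [hVtri hij, mul_zero]
    · have : d⁄dX ℚ (U i j) = 0 := by
        rcases hij.eq_or_lt with rfl | hij
        · rw [hUdiag]; simp
        · rw [hUtri hij, map_zero]
      rw [dMat, Matrix.map_apply, this, zero_mul]
  have htrU' : trace (dMat Uᵀ * Vᵀ) = 0 := by
    have : dMat Uᵀ = (dMat U)ᵀ := by ext1 i j; simp [dMat]
    rw [this, ← Matrix.transpose_mul, Matrix.trace_transpose, Matrix.trace_mul_comm, htrU]
  have key : trace (-A.map C * (Vᵀ * F * V)) = trace (dMat L * F) := by
    rw [← hdM, hM, dMat_mul, dMat_mul, Matrix.add_mul, Matrix.add_mul, Matrix.add_mul,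
      Matrix.trace_add, Matrix.trace_add]
    have e1 : dMat U * L * Uᵀ * (Vᵀ * F * V) = dMat U * V := by
      calc _ = dMat U * (L * ((Uᵀ * Vᵀ) * F)) * V := by simp only [Matrix.mul_assoc]
        _ = _ := by rw [hUV', Matrix.one_mul, hLF, Matrix.mul_one]
    have e2 : trace (U * dMat L * Uᵀ * (Vᵀ * F * V)) = trace (dMat L * F) := by
      calc _ = trace (U * (dMat L * ((Uᵀ * Vᵀ) * F)) * V) := by simp only [Matrix.mul_assoc]
        _ = _ := by
          rw [hUV', Matrix.one_mul, Matrix.trace_mul_comm, ← Matrix.mul_assoc, hVU,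
            Matrix.one_mul]
    have e3 : trace (U * L * dMat Uᵀ * (Vᵀ * F * V)) = trace (dMat Uᵀ * Vᵀ) := by
      calc _ = trace ((U * L) * (dMat Uᵀ * Vᵀ * F * V)) := by simp only [Matrix.mul_assoc]
        _ = trace (dMat Uᵀ * Vᵀ * (F * ((V * U) * L))) := by
          rw [Matrix.trace_mul_comm]; simp only [Matrix.mul_assoc]
        _ = _ := by rw [hVU, Matrix.one_mul, hFL, Matrix.mul_one]
    rw [e1, e2, e3, htrU, htrU', zero_add, add_zero]
  rw [Matrix.neg_mul, Matrix.trace_neg, neg_eq_iff_eq_neg] at key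
  rw [key]
  have hdL : dMat L = Matrix.diagonal fun i => -d⁄dX ℚ (X ^ 2 * u i) := by
    ext1 i j
    rcases eq_or_ne i j with rfl | hij
    · simp [dMat, hL]
    · simp [dMat, hL, hij]
  rw [hdL, hF, Matrix.diagonal_mul_diagonal, Matrix.trace_diagonal, ← sum_neg_distrib]
  exact sum_congr rfl fun i _ => by rw [nodeSeries]; ring

end Trace

theorem numClosedWalks_eq_trace {V : Type*} [Fintype V] [DecidableEq V] (G : SimpleGraph V)
    [DecidableRel G.Adj] (k : ℕ) :
    (numClosedWalks k G : ℚ) = trace (G.adjMatrix ℚ ^ k) := by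
  rw [numClosedWalks, Nat.card_sigma, Matrix.trace, Nat.cast_sum]
  refine sum_congr rfl fun v _ => ?_
  rw [Matrix.diag_apply, SimpleGraph.adjMatrix_pow_apply_eq_card_walk]
  congr 1
  exact Nat.card_eq_fintype_card

end GreedyWalks

/-! ### Transfer to the given degree sequences. -/

namespace GreedyWalks

open Finset PowerSeries Matrix Forest

variable {n : ℕ}

/-- A finite sequence, continued by zeros. -/
def extend (d : Fin n → ℕ) (i : ℕ) : ℕ := if h : i < n then d ⟨i, h⟩ else 0

/-- The numbers of children in the greedy tree, continued by zeros. -/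
def numChildren (d : Fin n → ℕ) (i : ℕ) : ℕ := if i = 0 then extend d i else extend d i - 1

theorem extend_val (d : Fin n → ℕ) (i : Fin n) : extend d i = d i := by simp [extend]

theorem extend_antitone {d : Fin n → ℕ} (hd : Antitone d) : Antitone (extend d) := by
  intro i j hij
  unfold extend
  split_ifs with h1 h2
  · exact hd (by simpa using hij)
  · omega
  · exact Nat.zero_le _
  · exact le_rfl

theorem numChildren_antitone {d : Fin n → ℕ} (hd : Antitone d) : Antitone (numChildren d) := by
  intro i j hij
  have := extend_antitone hd hij
  unfold numChildren
  split_ifs <;> omega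

theorem numChildren_val (d : Fin n → ℕ) (i : Fin n) : numChildren d i = greedyNumChildren d i := by
  rw [numChildren, greedyNumChildren, extend_val]

theorem sum_Iio_val (f : ℕ → ℕ) (i : Fin n) : ∑ m ∈ Iio i, f m = ∑ m ∈ range i, f m := by
  rw [← Nat.Iio_eq_range, ← Fin.map_valEmbedding_Iio, sum_map]
  rfl

theorem sum_Iic_val (f : ℕ → ℕ) (i : Fin n) : ∑ m ∈ Iic i, f m = ∑ m ∈ range (i + 1), f m := by
  have : range ((i : ℕ) + 1) = Iic (i : ℕ) := by ext; simp
  rw [this, ← Fin.map_valEmbedding_Iic, sum_map]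
  rfl

theorem firstChild_val (d : Fin n → ℕ) (i : Fin n) :
    firstChild (numChildren d) i = greedyFirstChild d i := by
  rw [firstChild, greedyFirstChild, ← sum_Iio_val]
  exact congrArg _ (sum_congr rfl fun m _ => numChildren_val d m)

theorem sum_extend (d : Fin n → ℕ) : ∑ i ∈ range n, extend d i = ∑ i, d i := by
  rw [← Fin.sum_univ_eq_sum_range]
  exact sum_congr rfl fun i _ => extend_val d i

theorem _root_.IsTreeDegreeSequence.sum_add_two {d : Fin n → ℕ} (h : IsTreeDegreeSequence d) :
    ∑ i, d i + 2 = 2 * n := by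
  classical
  obtain ⟨-, T, hT, hd⟩ := h
  have h1 := T.sum_degrees_eq_twice_card_edges
  have h2 := hT.card_edgeFinset
  rw [Fintype.card_fin] at h2
  have h3 : ∑ i, d i = ∑ v, T.degree v := sum_congr rfl fun v _ => by
    rw [← hd v, ← SimpleGraph.card_neighborSet_eq_degree, Set.ncard_eq_toFinset_card',
      Set.toFinset_card]
  omega

theorem _root_.IsTreeDegreeSequence.pos {d : Fin n → ℕ} (h : IsTreeDegreeSequence d) (hn : 2 ≤ n)
    (i : Fin n) : 1 ≤ d i := by
  classical
  obtain ⟨-, T, hT, hd⟩ := h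
  have : Nontrivial (Fin n) := Fin.nontrivial_iff_two_le.2 hn
  have := hT.connected.preconnected.degree_pos_of_nontrivial i
  rwa [← hd i, Set.ncard_eq_toFinset_card', Set.toFinset_card,
    SimpleGraph.card_neighborSet_eq_degree]

theorem extend_pos {d : Fin n → ℕ} (h : IsTreeDegreeSequence d) (hn : 2 ≤ n) {i : ℕ} (hi : i < n) :
    1 ≤ extend d i := by
  rw [extend, dif_pos hi]
  exact h.pos hn _

theorem numChildren_add_one {d : Fin n → ℕ} (h : IsTreeDegreeSequence d) (hn : 2 ≤ n) {i : ℕ}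
    (hi : i < n) : (if i = 0 then numChildren d i else numChildren d i + 1) = extend d i := by
  have := extend_pos h hn hi
  unfold numChildren
  split_ifs <;> omega

theorem isTreeCount {d : Fin n → ℕ} (h : IsTreeDegreeSequence d) (hn : 2 ≤ n) :
    IsTreeCount n (numChildren d) := by
  have hsum := h.sum_add_two
  rw [← sum_extend] at hsum
  have key : ∀ m, m + 1 ≤ n → ∑ i ∈ range (m + 1), numChildren d i + m =
      ∑ i ∈ range (m + 1), extend d i := by
    intro m
    induction m with
    | zero => simp [numChildren]
    | succ m ih =>
      intro hm
      have h1 := extend_pos h hn (i := m + 1) (by omega)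
      rw [sum_range_succ, sum_range_succ _ (m + 1), ← ih (by omega), numChildren, if_neg (by omega)]
      omega
  have htotal : firstChild (numChildren d) n = n := by
    obtain ⟨m, rfl⟩ := Nat.exists_eq_add_of_le' (show 1 ≤ n by omega)
    have := key m le_rfl
    rw [firstChild]
    omega
  refine ⟨fun i hi => ?_, htotal⟩
  have hanti := numChildren_antitone h.1
  -- Either vertex `i - 1` is childless, and then so are all later ones and every label is already
  -- used; or the first `i` vertices have at least one child each.
  rcases Nat.eq_zero_or_pos (numChildren d (i - 1)) with h0 | h0
  · have h1 : ∑ m ∈ range n, numChildren d m = ∑ m ∈ range i, numChildren d m ∨ i = 0 := by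
      rcases Nat.eq_zero_or_pos i with h2 | h2
      · exact Or.inr h2
      · left
        refine (sum_subset (range_subset_range.2 hi.le) fun m _ hm => ?_).symm
        have := hanti (show i - 1 ≤ m by simp at hm; omega)
        omega
    rw [firstChild] at htotal ⊢
    omega
  · have h1 : i * 1 ≤ ∑ m ∈ range i, numChildren d m := by
      have := card_nsmul_le_sum (range i) (numChildren d) 1 fun m hm => by
        have := hanti (show m ≤ i - 1 by have := mem_range.1 hm; omega)
        omega
      simpa using this
    rw [firstChild]
    omega

/-- The index shift stems from the logarithmic derivative; length `0` is treated separately. -/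
theorem coeff_treeWalks_greedy {d : Fin n → ℕ} (h : IsTreeDegreeSequence d) (hn : 2 ≤ n)
    {t : ℕ → Forest} (ht : IsGreedyFamily n (numChildren d) t) (k : ℕ) :
    (numClosedWalks (k + 1) (greedyTree d) : ℚ) = coeff k (treeWalks (t 0)) := by
  classical
  have hc := isTreeCount h hn
  have hR : ∀ i j : Fin n, IsGreedyChild d i j ↔ (j : ℕ) ∈ Ico (firstChild (numChildren d) i)
      (firstChild (numChildren d) i + numChildren d i) := fun i j => by
    rw [mem_Ico, firstChild_val, numChildren_val, IsGreedyChild]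
  have hlt : ∀ i j : Fin n, IsGreedyChild d i j → i < j := fun i j hij => by
    rw [hR, mem_Ico] at hij
    exact (hc.lt i i.2).trans_le hij.1
  have huniq : ∀ i i' j : Fin n, IsGreedyChild d i j → IsGreedyChild d i' j → i = i' := by
    intro i i' j h1 h2
    rw [hR, mem_Ico, ← firstChild_succ] at h1 h2
    rcases lt_trichotomy (i : ℕ) i' with h3 | h3 | h3
    · have := firstChild_mono (numChildren d) (show (i : ℕ) + 1 ≤ i' from h3)
      omega
    · exact Fin.ext h3
    · have := firstChild_mono (numChildren d) (show (i' : ℕ) + 1 ≤ i from h3)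
      omega
  rw [numClosedWalks_eq_trace, ht.treeWalks_eq hc,
    ← Fin.sum_univ_eq_sum_range fun i => nodeSeries (walkSum (t i))]
  refine trace_pow_of_parent (IsGreedyChild d) hlt huniq (fun i => walkSum (t i)) (fun i => ?_) _
    (fun i j => ?_) k
  · have h1 := firstChild_mono (numChildren d) (show (i : ℕ) + 1 ≤ n from i.2)
    rw [hc.total, firstChild_succ] at h1
    rw [ht.walkSum_eq i.2]
    simp only [hR]
    rw [Fin.sum_univ_eq_sum_range fun j => if j ∈ Ico (firstChild (numChildren d) i)
      (firstChild (numChildren d) i + numChildren d i) then (1 - X ^ 2 * walkSum (t j))⁻¹ else 0,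
      sum_ite_mem, inter_eq_right.2]
    intro j hj
    rw [mem_Ico] at hj
    exact mem_range.2 (by omega)
  · rw [SimpleGraph.adjMatrix_apply, greedyTree, SimpleGraph.fromRel_adj]
    by_cases h1 : IsGreedyChild d i j
    · have h2 : ¬ IsGreedyChild d j i := fun h2 => lt_asymm (hlt _ _ h1) (hlt _ _ h2)
      simp [h1, h2, (hlt _ _ h1).ne]
    · by_cases h2 : IsGreedyChild d j i
      · simp [h1, h2, (hlt _ _ h2).ne']
      · simp [h1, h2]

theorem excess_map_range (d : ℕ → ℕ) (n m : ℕ) :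
    excess ((List.range n).map d : List ℕ) m = ∑ i ∈ range n, (d i - m) := by
  rw [excess, Multiset.map_coe, List.map_map, Multiset.sum_coe]
  rfl

theorem exists_threshold {b : ℕ → ℕ} (hb : Antitone b) (m n : ℕ) :
    ∃ s ≤ n, (∀ i < s, m ≤ b i) ∧ ∀ i, s ≤ i → i < n → b i ≤ m := by
  induction n with
  | zero => exact ⟨0, le_rfl, fun i hi => by omega, fun i _ hi => by omega⟩
  | succ n ih =>
    obtain ⟨s, hs, h1, h2⟩ := ih
    by_cases hm : m ≤ b n
    · exact ⟨n + 1, le_rfl, fun i hi => hm.trans (hb (by omega)), fun i h3 h4 => by omega⟩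
    · refine ⟨s, by omega, h1, fun i h3 h4 => ?_⟩
      rcases Nat.lt_succ_iff_lt_or_eq.1 h4 with h5 | rfl
      · exact h2 i h3 h5
      · omega

/-- Only the terms of `b` above `m` contribute, and they form an initial segment of some length `s`;
compare the initial sums of that length. -/
theorem sum_sub_le_sum_sub {b d : ℕ → ℕ} (hb : Antitone b) {n : ℕ}
    (h : ∀ s ≤ n, ∑ i ∈ range s, b i ≤ ∑ i ∈ range s, d i) (m : ℕ) :
    ∑ i ∈ range n, (b i - m) ≤ ∑ i ∈ range n, (d i - m) := by
  obtain ⟨s, hs, h1, h2⟩ := exists_threshold hb m n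
  have h3 : ∑ i ∈ range n, (b i - m) = ∑ i ∈ range s, (b i - m) :=
    (sum_subset (range_subset_range.2 hs) fun i hi hi' => by
      have := h2 i (by simpa using hi') (mem_range.1 hi)
      omega).symm
  have h4 : ∑ i ∈ range s, (b i - m) + ∑ i ∈ range s, m = ∑ i ∈ range s, b i := by
    rw [← sum_add_distrib]
    exact sum_congr rfl fun i hi => Nat.sub_add_cancel (h1 i (mem_range.1 hi))
  have h5 : ∑ i ∈ range s, d i ≤ ∑ i ∈ range s, (d i - m) + ∑ i ∈ range s, m := by
    rw [← sum_add_distrib]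
    exact sum_le_sum fun i _ => by omega
  have h6 : ∑ i ∈ range s, (d i - m) ≤ ∑ i ∈ range n, (d i - m) :=
    sum_le_sum_of_subset (range_subset_range.2 hs)
  have := h s hs
  omega

theorem sum_extend_le {B D : Fin n → ℕ} (h : MajorizedBy B D) (s : ℕ) (hs : s ≤ n) :
    ∑ i ∈ range s, extend B i ≤ ∑ i ∈ range s, extend D i := by
  rcases s with _ | s
  · simp
  · have h1 := h (Equiv.refl _) ⟨s, hs⟩
    have h2 := sum_Iic_val (extend B) ⟨s, hs⟩
    have h3 := sum_Iic_val (extend D) ⟨s, hs⟩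
    simp only [extend_val] at h2 h3
    rw [← h2, ← h3]
    exact h1

theorem degs_greedy {d : Fin n → ℕ} (h : IsTreeDegreeSequence d) (hn : 2 ≤ n)
    {t : ℕ → Forest} (ht : IsGreedyFamily n (numChildren d) t) :
    degs (t 0) = ((List.range n).map (extend d) : List ℕ) := by
  rw [ht.degs_eq (isTreeCount h hn)]
  exact congrArg _ (List.map_congr_left fun i hi => numChildren_add_one h hn (List.mem_range.1 hi))

theorem pairwise_map_range {d : ℕ → ℕ} (hd : Antitone d) (n : ℕ) :
    ((List.range n).map d).Pairwise (· ≥ ·) := by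
  rw [List.range_eq_range']
  exact IsGreedyFamily.pairwise_map_range' hd 0 n

theorem greedy_ordered {d : Fin n → ℕ} (h : IsTreeDegreeSequence d) (hn : 2 ≤ n)
    {t : ℕ → Forest} (ht : IsGreedyFamily n (numChildren d) t) : Ordered (t 0) := by
  refine ht.ordered (isTreeCount h hn) (numChildren_antitone h.1) fun i hi hin => ?_
  have h1 := extend_antitone h.1 (Nat.zero_le i)
  have h2 := extend_pos h hn hin
  rw [numChildren, numChildren, if_neg (by omega), if_pos rfl]
  omega

theorem numClosedWalks_le_and_lt {B D : Fin n → ℕ} (hB : IsTreeDegreeSequence B)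
    (hD : IsTreeDegreeSequence D) (hBD : MajorizedBy B D) (hn : 2 ≤ n) (hne : B ≠ D) :
    (∀ k, numClosedWalks (k + 1) (greedyTree B) ≤ numClosedWalks (k + 1) (greedyTree D)) ∧
      ∀ k, 2 ≤ k → numClosedWalks (2 * k - 1 + 1) (greedyTree B) <
        numClosedWalks (2 * k - 1 + 1) (greedyTree D) := by
  obtain ⟨b, hb⟩ := exists_isGreedyFamily (isTreeCount hB hn)
  obtain ⟨t, ht⟩ := exists_isGreedyFamily (isTreeCount hD hn)
  have hsum := hB.sum_add_two.trans hD.sum_add_two.symm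
  rw [← sum_extend, ← sum_extend] at hsum
  have hdB := degs_greedy hB hn hb
  have hdD := degs_greedy hD hn ht
  have hmax := (greedy_ordered hD hn ht).treeWalks_max (b 0) (by simp [hdB, hdD])
    (by
      rw [← excess_zero, ← excess_zero, hdB, hdD, excess_map_range, excess_map_range]
      simpa using hsum)
    (by
      intro y hy
      rw [hdD, Multiset.mem_coe, List.mem_map] at hy
      obtain ⟨i, hi, rfl⟩ := hy
      exact extend_pos hD hn (List.mem_range.1 hi))
    (fun m => by
      rw [hdB, hdD, excess_map_range, excess_map_range]
      exact sum_sub_le_sum_sub (extend_antitone hB.1) (sum_extend_le hBD) m)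
  have hdne : degs (b 0) ≠ degs (t 0) := by
    intro h
    rw [hdB, hdD, Multiset.coe_eq_coe] at h
    have h1 := h.eq_of_pairwise (fun _ _ _ _ h1 h2 => le_antisymm h2 h1)
      (pairwise_map_range (extend_antitone hB.1) n) (pairwise_map_range (extend_antitone hD.1) n)
    refine hne (funext fun i => ?_)
    have h2 := List.map_inj_left.1 h1 i (List.mem_range.2 i.2)
    rwa [extend_val, extend_val] at h2
  refine ⟨fun k => ?_, fun k hk => ?_⟩
  · rw [← Nat.cast_le (α := ℚ), coeff_treeWalks_greedy hB hn hb, coeff_treeWalks_greedy hD hn ht]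
    exact hmax.1 k
  · rw [← Nat.cast_lt (α := ℚ), coeff_treeWalks_greedy hB hn hb, coeff_treeWalks_greedy hD hn ht]
    exact hmax.2 hdne k hk

theorem numClosedWalks_zero {V : Type*} [Fintype V] (G : SimpleGraph V) :
    numClosedWalks 0 G = Fintype.card V := by
  classical
  have := numClosedWalks_eq_trace G 0
  rw [pow_zero, Matrix.trace_one] at this
  exact_mod_cast this

/-- For `n = 1` the only sequence is `0`. Excluding it ensures positive degrees, on which the
identity between degree and child count plus one relies. -/
theorem _root_.IsTreeDegreeSequence.two_le {B D : Fin n → ℕ} (hB : IsTreeDegreeSequence B)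
    (hD : IsTreeDegreeSequence D) (hne : B ≠ D) : 2 ≤ n := by
  by_contra! hn
  have h1 := hB.sum_add_two
  have h2 := hD.sum_add_two
  obtain rfl : n = 1 := by omega
  refine hne (funext fun i => ?_)
  have := Subsingleton.elim i 0
  subst this
  simp at h1 h2
  omega

end GreedyWalks

open GreedyWalks in
theorem theorem4p3 {n : ℕ} (B D : Fin n → ℕ)
    (hB : IsTreeDegreeSequence B) (hD : IsTreeDegreeSequence D) (hBD : MajorizedBy B D) :
    (∀ k : ℕ, numClosedWalks k (greedyTree B) ≤ numClosedWalks k (greedyTree D)) ∧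
    (B ≠ D → ∀ k : ℕ, Even k → 4 ≤ k →
      numClosedWalks k (greedyTree B) < numClosedWalks k (greedyTree D)) := by
  rcases eq_or_ne B D with rfl | hne
  · exact ⟨fun k => le_rfl, fun h => absurd rfl h⟩
  obtain ⟨h1, h2⟩ := numClosedWalks_le_and_lt hB hD hBD (hB.two_le hD hne) hne
  refine ⟨fun k => ?_, fun _ k hk h4 => ?_⟩
  · cases k with
    | zero => rw [numClosedWalks_zero, numClosedWalks_zero]
    | succ k => exact h1 k
  · obtain ⟨m, rfl⟩ := hk
    have := h2 m (by omega)
    rwa [show 2 * m - 1 + 1 = m + m by omega] at this
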